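/- Let $(\Omega,\mathcal F,\mathbb P)$ be a probability space with an increasing sequence $(\mathcal F_n)_{n\ge 0}$ of sub-$\sigma$-algebras of $\mathcal F$ and conditional expectations $\mathbb E_n=\mathbb E(\,\cdot\mid\mathcal F_n)$, and for measurable $f:\Omega\to\mathbb R$ let $M(f)=\sup_{n\ge 0}|\mathbb E_n f|$ be the Doob maximal function. (Here $\mathbb E_n f=\mathbb E_n f^+-\mathbb E_n f^-$ where $\mathbb E_n|f|<\infty$, and $|\mathbb E_n f|:=\infty$ where $\mathbb E_n|f|=\infty$.) Let $\varphi:\Omega\times[0,\infty)\to[0,\infty)$ be a Musielak--Orlicz function, that is, for every $x\in\Omega$ the function $\varphi(x,\cdot)$ is non-decreasing with $\varphi(x,0)=0$ and $\lim_{t\to\infty}\varphi(x,t)=\infty$, and for every $t\ge 0$ the function $\varphi(\cdot,t)$ is measurable; assume also that $\varphi(\cdot,t)\in L^1(\Omega)$ for every $t\ge 0$. For measurable $F:\Omega\to[0,\infty]$ put $$\|F\|_{L^\varphi}=\inf\Big\{\lambda\in(0,\infty):\ \int_\Omega\varphi\big(x,F(x)/\lambda\big)\,d\mathbb P(x)\le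 1\Big\},$$ with $\inf\emptyset=\infty$ and $\varphi(x,\infty)=\infty$. For $q\in[1,\infty)$ write $\varphi\in A_q$ if $\varphi(x,t)>0$ for all $x\in\Omega$ and $t>0$, and there is a constant $K\in(0,\infty)$ such that for all $t\in(0,\infty)$ and all $n\ge 0$, almost everywhere, $$\mathbb E_n(\varphi(\cdot,t))\,\big[\mathbb E_n\big(\varphi(\cdot,t)^{-1/(q-1)}\big)\big]^{q-1}\le K\ \text{ if } q>1,\qquad \frac{\mathbb E_n(\varphi(\cdot,t))}{\varphi(\cdot,t)}\le K\ \text{ if } q=1 .$$ Let $A_\infty=\bigcup_{q\ge 1}A_q$ and $q(\varphi)=\inf\{q\in[1,\infty):\varphi\in A_q\}$. Suppose that $\varphi\in A_\infty$ and that $\varphi$ is of uniformly lower type $p^-\in(0,\infty)$ and of uniformly upper type $p^+\in(0,\infty)$: there is a constant $c>0$ such that, for all $x\in\Omega$ and $t\ge 0$, $\varphi(x,st)\le c\,s^{p^-}\varphi(x,t)$ for all $s\in(0,1)$ and $\varphi(x,st)\le c\,s^{p^+}\varphi(x,t)$ for all $s\ge 1$. Suppose further that $$q(\varphi)<p^-\le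 p^+<\infty .$$ **Theorem (Fefferman--Stein vector-valued Doob maximal inequality).** For every $r\in(1,\infty)$ there is a constant $C\in(0,\infty)$ such that, for every sequence $(f_j)_{j\in\mathbb N}$ of measurable functions $f_j:\Omega\to\mathbb R$, $$\Big\|\Big(\sum_{j\in\mathbb N}[M(f_j)]^r\Big)^{1/r}\Big\|_{L^\varphi}\le C\,\Big\|\Big(\sum_{j\in\mathbb N}|f_j|^r\Big)^{1/r}\Big\|_{L^\varphi}.$$ -/

import Mathlib

open MeasureTheory Filter
open scoped NNReal ENNReal

namespace MusielakOrlicz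

variable {Ω : Type*} [mΩ : MeasurableSpace Ω]

/-- `φ : Ω × [0,∞) → [0,∞)` is a Musielak–Orlicz function: every `φ(x, ·)` is an Orlicz function
(non-decreasing, zero at zero, tending to infinity), and every `φ(·, t)` is measurable. -/
structure IsMusielakOrlicz (φ : Ω → ℝ≥0 → ℝ≥0) : Prop where
  monotone : ∀ x, Monotone (φ x)
  zero : ∀ x, φ x 0 = 0
  tendsto_atTop : ∀ x, Tendsto (φ x) atTop atTop
  measurable : ∀ t, Measurable fun x => φ x t

/-- `φ` is of uniformly lower type `p ∈ (0,∞)`. -/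
def UniformLowerType (φ : Ω → ℝ≥0 → ℝ≥0) (p : ℝ) : Prop :=
  0 < p ∧ ∃ C : ℝ≥0, 0 < C ∧ ∀ (x : Ω) (t s : ℝ≥0), 0 < s → s < 1 →
    φ x (s * t) ≤ C * s ^ p * φ x t

/-- `φ` is of uniformly upper type `p ∈ (0,∞)`. -/
def UniformUpperType (φ : Ω → ℝ≥0 → ℝ≥0) (p : ℝ) : Prop :=
  0 < p ∧ ∃ C : ℝ≥0, 0 < C ∧ ∀ (x : Ω) (t s : ℝ≥0), 1 ≤ s →
    φ x (s * t) ≤ C * s ^ p * φ x t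

/-- The uniform Muckenhoupt condition `A_q`, `q ∈ [1,∞)`, with respect to a filtration:
`φ` is positive and, with one constant `K` for all `t ∈ (0,∞)` and all `n`,
`E_n(φ(·,t)) [E_n(φ(·,t)^{-1/(q-1)})]^{q-1} ≤ K` almost everywhere if `q > 1`, and
`E_n(φ(·,t)) / φ(·,t) ≤ K` almost everywhere if `q = 1`. Here `E_n` is the conditional expectation
of `[0,∞]`-valued functions, so that no integrability of the negative power is presupposed. -/
def IsAq (P : Measure Ω) (ℱ : Filtration ℕ mΩ) (φ : Ω → ℝ≥0 → ℝ≥0) (q : ℝ) : Prop :=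
  1 ≤ q ∧ (∀ (x : Ω) (t : ℝ≥0), 0 < t → 0 < φ x t) ∧
    ∃ K : ℝ≥0, 0 < K ∧ ∀ t : ℝ≥0, 0 < t → ∀ n : ℕ, ∀ᵐ x ∂P,
      (1 < q →
        condLExp (ℱ n) P (fun y => (φ y t : ℝ≥0∞)) x *
          (condLExp (ℱ n) P (fun y => (φ y t : ℝ≥0∞) ^ (-(1 / (q - 1)))) x) ^ (q - 1) ≤ K) ∧
      (q = 1 → condLExp (ℱ n) P (fun y => (φ y t : ℝ≥0∞)) x / (φ x t : ℝ≥0∞) ≤ K)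

/-- `φ ∈ A_∞`, that is, `φ ∈ A_q` for some `q ∈ [1,∞)`. -/
def IsAInfty (P : Measure Ω) (ℱ : Filtration ℕ mΩ) (φ : Ω → ℝ≥0 → ℝ≥0) : Prop :=
  ∃ q : ℝ, IsAq P ℱ φ q

/-- The critical index `q(φ) = inf {q ∈ [1,∞) : φ ∈ A_q}` (used for `φ ∈ A_∞`). -/
noncomputable def criticalIndex (P : Measure Ω) (ℱ : Filtration ℕ mΩ)
    (φ : Ω → ℝ≥0 → ℝ≥0) : ℝ :=
  sInf {q : ℝ | IsAq P ℱ φ q}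

/-- `|E(f | m)|` as a `[0,∞]`-valued function. Where `E(|f| | m) < ∞`, the conditional expectation
is `E(f⁺ | m) - E(f⁻ | m)`; for integrable `f` this is the usual one. Where `E(|f| | m) = ∞`
the value is `∞`. -/
noncomputable def absCondExp (P : Measure Ω) (m : MeasurableSpace Ω) (f : Ω → ℝ) (x : Ω) : ℝ≥0∞ :=
  open scoped Classical in
  if condLExp m P (fun y => ‖f y‖ₑ) x = ∞ then ∞
  else ‖(condLExp m P (fun y => ENNReal.ofReal (f y)) x).toReal -
      (condLExp m P (fun y => ENNReal.ofReal (-f y)) x).toReal‖ₑ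

/-- The Doob maximal function `M(f) = sup_n |E_n f|`. -/
noncomputable def doobMax (P : Measure Ω) (ℱ : Filtration ℕ mΩ) (f : Ω → ℝ) (x : Ω) : ℝ≥0∞ :=
  ⨆ n : ℕ, absCondExp P (ℱ n) f x

/-- `φ(x, t)` for `t ∈ [0,∞]`, with `φ(x, ∞) = ∞ = lim_{t → ∞} φ(x, t)`. -/
noncomputable def extend (φ : Ω → ℝ≥0 → ℝ≥0) (x : Ω) (t : ℝ≥0∞) : ℝ≥0∞ :=
  open scoped Classical in
  if t = ∞ then ∞ else (φ x t.toNNReal : ℝ≥0∞)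

/-- The Luxemburg norm `inf {λ ∈ (0,∞) : ∫ φ(x, F(x)/λ) dP(x) ≤ 1}` of a `[0,∞]`-valued function
`F`; the infimum is `∞` if there is no such `λ`. -/
noncomputable def luxemburgNorm (P : Measure Ω) (φ : Ω → ℝ≥0 → ℝ≥0) (F : Ω → ℝ≥0∞) : ℝ≥0∞ :=
  ⨅ (c : ℝ≥0) (_ : 0 < c) (_ : ∫⁻ x, extend φ x (F x / (c : ℝ≥0∞)) ∂P ≤ 1), (c : ℝ≥0∞)

end MusielakOrlicz

/-! For fixed t the function φ(·,t) is an ordinary Muckenhoupt weight, with constants independent of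
t. So the theorem follows from weighted inequalities at two exponents and an interpolation over the
heights t.

Weights. Since q(φ) < p⁻, some q < p⁻ has φ ∈ A_q, and `IsAq.exists_isMuckenhouptPair` places all
φ(·,t) in A_s, uniformly in t, for each s > q. Two such exponents are used: s₁ ∈ (q, p⁻) and s₂ >
p⁺. The gap q < p⁻ is already strict, so no self-improvement of A_p weights is needed and the
filtration can be arbitrary.

Weighted bounds. `IsMuckenhouptPair.condMax_rpow_le` dominates the Doob maximal function pointwise
by a composition of two maximal functions, taken relative to the measures σ dP and w dP. Each of
these is bounded by a stopping-time argument, which gives the scalar bound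
`exists_condMax_strong_type` on L^p(w). In L^r(w) the ℓ^r-valued inequality is a sum of scalar ones,
and Rubio de Francia extrapolation (`exists_extrapolation`) carries it to every exponent p > 1: this
is `exists_lrNorm_condMax_le`.

Interpolation. At each dyadic height t the sequence is split according to whether its ℓ^r norm
exceeds t. The exponent s₁ controls the large part and s₂ the small part
(`lintegral_lt_lrNorm_condMax_le`). After summation over t, lower type (s₁ < p⁻) and upper type (s₂
> p⁺) produce convergent geometric series, hence the modular inequality `exists_modular_condMax_le`.
Lower type finally turns the modular constant into a dilation (`exists_extend_div_le`), which is a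
constant in the Luxemburg norm. -/

namespace MusielakOrlicz

/-! ### Dyadic heights and geometric sums over them. -/

section Dyadic

/-- The dyadic number `2 ^ k`. -/
noncomputable def dyadic (k : ℤ) : ℝ≥0 := 2 ^ (k : ℝ)

lemma dyadic_pos (k : ℤ) : 0 < dyadic k := NNReal.rpow_pos (by norm_num)

lemma dyadic_succ (k : ℤ) : dyadic (k + 1) = 2 * dyadic k := by
  simp only [dyadic, Int.cast_add, Int.cast_one]
  rw [NNReal.rpow_add (by norm_num), NNReal.rpow_one, mul_comm]

lemma dyadic_neg (k : ℤ) : dyadic (-k) = (dyadic k)⁻¹ := by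
  simp [dyadic, NNReal.rpow_neg]

lemma dyadic_sub_natCast (k : ℤ) (m : ℕ) : dyadic (k - m) = dyadic k * (2⁻¹) ^ m := by
  simp only [dyadic, Int.cast_sub, Int.cast_natCast]
  rw [NNReal.rpow_sub (by norm_num), NNReal.rpow_natCast, div_eq_mul_inv, inv_pow]

lemma dyadic_le_dyadic_iff {k l : ℤ} : dyadic k ≤ dyadic l ↔ k ≤ l := by
  rw [dyadic, dyadic, NNReal.rpow_intCast, NNReal.rpow_intCast]
  exact zpow_le_zpow_iff_right₀ one_lt_two

lemma dyadic_coe_pos (k : ℤ) : (0 : ℝ≥0∞) < dyadic k := by exact_mod_cast dyadic_pos k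

lemma dyadic_coe_ne_zero (k : ℤ) : (dyadic k : ℝ≥0∞) ≠ 0 := (dyadic_coe_pos k).ne'

lemma exists_dyadic_lt_le {u : ℝ≥0∞} (h0 : u ≠ 0) (ht : u ≠ ∞) :
    ∃ k : ℤ, (dyadic k : ℝ≥0∞) < u ∧ u ≤ 2 * dyadic k := by
  lift u to ℝ≥0 using ht
  have h0' : 0 < u := pos_iff_ne_zero.2 (by exact_mod_cast h0)
  obtain ⟨k, hk1, hk2⟩ := exists_mem_Ioc_zpow h0' (one_lt_two)
  refine ⟨k, ?_, ?_⟩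
  · rw [dyadic, NNReal.rpow_intCast]; exact_mod_cast hk1
  · have : u ≤ 2 * dyadic k := by
      rw [← dyadic_succ]; simpa only [dyadic, NNReal.rpow_intCast] using hk2
    exact_mod_cast this

lemma exists_dyadic_le_lt {u : ℝ≥0∞} (h0 : u ≠ 0) (ht : u ≠ ∞) :
    ∃ k : ℤ, (dyadic k : ℝ≥0∞) ≤ u ∧ u < 2 * dyadic k := by
  lift u to ℝ≥0 using ht
  have h0' : 0 < u := pos_iff_ne_zero.2 (by exact_mod_cast h0)
  obtain ⟨k, hk1, hk2⟩ := exists_mem_Ico_zpow h0' (one_lt_two)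
  refine ⟨k, ?_, ?_⟩
  · rw [dyadic, NNReal.rpow_intCast]; exact_mod_cast hk1
  · have : u < 2 * dyadic k := by
      rw [← dyadic_succ]; simpa only [dyadic, NNReal.rpow_intCast] using hk2
    exact_mod_cast this

/-- A geometric series of ratio 2^(-δ), dominated by its largest term, at the last dyadic number
below y. -/
lemma exists_tsum_dyadic_le {δ : ℝ} (hδ : 0 < δ) :
    ∃ C : ℝ≥0, 0 < C ∧ ∀ y : ℝ≥0∞,
      ∑' k : ℤ, (if (dyadic k : ℝ≥0∞) ≤ y then (dyadic k : ℝ≥0∞) ^ δ else 0) ≤ C * y ^ δ := by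
  set ρ : ℝ≥0 := (2⁻¹ : ℝ≥0) ^ δ with hρ
  have hρ1 : ρ < 1 := NNReal.rpow_lt_one (by norm_num) hδ
  have hC : (0 : ℝ≥0) < (1 - ρ)⁻¹ := inv_pos.2 (tsub_pos_of_lt hρ1)
  refine ⟨(1 - ρ)⁻¹, hC, fun y => ?_⟩
  rcases eq_or_ne y 0 with rfl | h0
  · simp [(dyadic_pos _).ne']
  rcases eq_or_ne y ∞ with rfl | ht
  · rw [ENNReal.top_rpow_of_pos hδ, ENNReal.mul_top (by exact_mod_cast hC.ne')]
    exact le_top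
  obtain ⟨K, hK1, hK2⟩ := exists_dyadic_le_lt h0 ht
  have hinj : Function.Injective (fun m : ℕ => K - (m : ℤ)) := by
    intro a b h; simpa using h
  rw [← hinj.tsum_eq]
  · calc _ ≤ ∑' m : ℕ, y ^ δ * (ρ : ℝ≥0∞) ^ m := by
          refine ENNReal.tsum_le_tsum fun m => ?_
          split_ifs with h
          · rw [dyadic_sub_natCast, ENNReal.coe_mul, ENNReal.mul_rpow_of_nonneg _ _ hδ.le]
            gcongr
            rw [hρ, ← ENNReal.coe_rpow_of_nonneg _ hδ.le, ← ENNReal.coe_pow]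
            rw [← NNReal.rpow_natCast, ← NNReal.rpow_natCast, ← NNReal.rpow_mul,
              ← NNReal.rpow_mul, mul_comm]
          · exact zero_le
      _ = _ := by
          rw [ENNReal.tsum_mul_left, ENNReal.tsum_geometric, mul_comm,
            ENNReal.coe_inv (tsub_pos_of_lt hρ1).ne', ENNReal.coe_sub, ENNReal.coe_one]
  · intro k hk
    have hk' : (dyadic k : ℝ≥0∞) ≤ y := by
      by_contra h; simp [h] at hk
    have : dyadic k < dyadic (K + 1) := by
      rw [dyadic_succ]; exact_mod_cast hk'.trans_lt hK2
    have : k < K + 1 := by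
      by_contra h
      exact absurd this (not_lt.2 (dyadic_le_dyadic_iff.2 (not_lt.1 h)))
    exact ⟨(K - k).toNat, by simp; omega⟩

lemma exists_tsum_dyadic_neg_le {δ : ℝ} (hδ : 0 < δ) :
    ∃ C : ℝ≥0, 0 < C ∧ ∀ y : ℝ≥0∞,
      ∑' k : ℤ, (if y ≤ (dyadic k : ℝ≥0∞) then (dyadic k : ℝ≥0∞) ^ (-δ) else 0)
        ≤ C * y ^ (-δ) := by
  obtain ⟨C, hC, h⟩ := exists_tsum_dyadic_le hδ
  refine ⟨C, hC, fun y => ?_⟩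
  rw [← (Equiv.neg ℤ).tsum_eq]
  have hy : y ^ (-δ) = y⁻¹ ^ δ := by rw [ENNReal.rpow_neg, ENNReal.inv_rpow]
  rw [hy]
  convert h y⁻¹ using 3 with k
  · have hd : ((dyadic (-k) : ℝ≥0) : ℝ≥0∞) = (dyadic k : ℝ≥0∞)⁻¹ := by
      rw [dyadic_neg, ENNReal.coe_inv (dyadic_pos k).ne']
    simp only [Equiv.neg_apply]
    simp only [hd, ENNReal.rpow_neg, ENNReal.inv_rpow, inv_inv]
    simp only [ENNReal.le_inv_iff_le_inv (a := y)]

lemma tsum_eq_top_of_forall_exists_le {ψ : ℤ → ℝ≥0∞} (h : ∀ B : ℝ≥0, ∃ k, (B : ℝ≥0∞) ≤ ψ k) :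
    ∑' k, ψ k = ∞ := by
  refine ENNReal.eq_top_of_forall_nnreal_le fun B => ?_
  obtain ⟨k, hk⟩ := h B
  exact hk.trans (ENNReal.le_tsum k)

end Dyadic

/-! ### Conditional expectations of [0,∞]-valued functions. -/

section CondLExp

variable {Ω : Type*} {m mΩ : MeasurableSpace Ω} {P : Measure Ω} [IsFiniteMeasure P]

lemma lintegral_mul_condLExp (hm : m ≤ mΩ) {f g : Ω → ℝ≥0∞} (hf : Measurable[m] f)
    (hg : Measurable g) :
    ∫⁻ x, f x * condLExp m P g x ∂P = ∫⁻ x, f x * g x ∂P := by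
  have hE : Measurable (condLExp m P g) := measurable_condLExp' m P g
  refine @Measurable.ennreal_induction Ω m
    (fun f => ∫⁻ x, f x * condLExp m P g x ∂P = ∫⁻ x, f x * g x ∂P) ?_ ?_ ?_ f hf
  · intro c s hs
    have h (g : Ω → ℝ≥0∞) : (fun x => s.indicator (fun _ => c) x * g x)
        = s.indicator (fun x => c * g x) := by
      ext x; by_cases hx : x ∈ s <;> simp [hx]
    rw [h, h, lintegral_indicator (hm _ hs), lintegral_indicator (hm _ hs),
      lintegral_const_mul _ hE, lintegral_const_mul _ hg, setLIntegral_condLExp hm _ _ hs]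
  · intro f₁ f₂ _ h1 h2 ih1 ih2
    simp only [Pi.add_apply, add_mul]
    replace h1 := h1.mono hm le_rfl
    rw [lintegral_add_left (by fun_prop), lintegral_add_left (by fun_prop), ih1, ih2]
  · intro fs h1 hmono ih
    replace h1 := fun n => (h1 n).mono hm le_rfl
    simp only [ENNReal.iSup_mul]
    rw [lintegral_iSup (by fun_prop), lintegral_iSup (by fun_prop)]
    · exact iSup_congr ih
    · exact fun i j hij x => mul_le_mul_left (hmono hij x) _
    · exact fun i j hij x => mul_le_mul_left (hmono hij x) _

lemma condLExp_mul_left (hm : m ≤ mΩ) {f g : Ω → ℝ≥0∞} (hf : Measurable[m] f)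
    (hg : Measurable g) :
    condLExp m P (fun x => f x * g x) =ᵐ[P] fun x => f x * condLExp m P g x := by
  refine (ae_eq_condLExp hm P _ (hf.mul (measurable_condLExp m P g)) fun s hs => ?_).symm
  rw [← lintegral_indicator (hm _ hs), ← lintegral_indicator (hm _ hs)]
  have h (g : Ω → ℝ≥0∞) : s.indicator (fun x => f x * g x)
      = fun x => s.indicator f x * g x := by
    ext x; by_cases hx : x ∈ s <;> simp [hx]
  change ∫⁻ x, s.indicator (fun x => f x * condLExp m P g x) x ∂P = _
  rw [h, h]
  exact lintegral_mul_condLExp hm (hf.indicator hs) hg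

/-- The zero set of the conditional expectation belongs to m, so g has integral zero over it. -/
lemma ae_condLExp_ne_zero (hm : m ≤ mΩ) {g : Ω → ℝ≥0∞} (hg : Measurable g)
    (h : ∀ᵐ x ∂P, g x ≠ 0) : ∀ᵐ x ∂P, condLExp m P g x ≠ 0 := by
  have hs : MeasurableSet[m] {x | condLExp m P g x = 0} :=
    measurable_condLExp m P g (measurableSet_singleton 0)
  have h0 : ∫⁻ x in {x | condLExp m P g x = 0}, g x ∂P = 0 := by
    rw [← setLIntegral_condLExp hm P g hs]
    exact (setLIntegral_congr_fun (hm _ hs) fun x hx => hx).trans (by simp)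
  rw [setLIntegral_eq_zero_iff (hm _ hs) hg] at h0
  filter_upwards [h0, h] with x h1 h2 h3 using h2 (h1 h3)

/-- A form of the conditional Jensen inequality for the power `θ ≤ 1`, with a factor `2`. -/
lemma condLExp_rpow_le (hm : m ≤ mΩ) {g : Ω → ℝ≥0∞} (hg : Measurable g)
    (h0 : ∀ᵐ x ∂P, g x ≠ 0) {θ : ℝ} (hθ0 : 0 < θ) (hθ1 : θ ≤ 1) :
    ∀ᵐ x ∂P, condLExp m P (fun y => g y ^ θ) x ≤ 2 * condLExp m P g x ^ θ := by
  set c := condLExp m P g with hc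
  have hcm : Measurable[m] c := measurable_condLExp m P g
  -- The first term dominates where g ≤ c, the second where g ≥ c because θ - 1 ≤ 0. Each of them
  -- has conditional expectation at most c^θ, whence the factor 2.
  have hmono : ∀ᵐ x ∂P, (fun y => g y ^ θ) x ≤ ((fun x => c x ^ θ) + fun x => c x ^ (θ - 1) * g x) x := by
    filter_upwards [ae_condLExp_ne_zero hm hg h0] with x hx
    simp only [Pi.add_apply]
    rcases eq_or_ne (c x) ∞ with ht | ht
    · simp [ht, ENNReal.top_rpow_of_pos hθ0]
    rcases le_total (g x) (c x) with h | h
    · exact le_add_right (ENNReal.rpow_le_rpow h hθ0.le)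
    · refine le_add_left ?_
      rcases eq_or_ne (g x) ∞ with hgt | hgt
      · rw [hgt, ENNReal.mul_top]
        · exact le_top
        · exact (ENNReal.rpow_pos (pos_iff_ne_zero.2 hx) ht).ne'
      have hgx : g x ≠ 0 := fun h' => hx (le_antisymm (h' ▸ h) zero_le)
      calc g x ^ θ = g x ^ (θ - 1) * g x := by
            conv_rhs => rw [← ENNReal.rpow_one (g x), ← ENNReal.rpow_mul, one_mul]
            rw [← ENNReal.rpow_add _ _ hgx hgt]; simp
        _ ≤ c x ^ (θ - 1) * g x := by
            refine mul_le_mul_left ?_ _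
            rw [← neg_sub 1 θ, ENNReal.rpow_neg, ENNReal.rpow_neg]
            exact ENNReal.inv_le_inv.2 (ENNReal.rpow_le_rpow h (by linarith))
  have h1 := condLExp_mono (mΩ := m) hmono
  have h2 := condLExp_add_left (mΩ := m) (P := P) (X := fun x => c x ^ θ)
    (fun x => c x ^ (θ - 1) * g x) ((hcm.mono hm le_rfl).pow_const θ).aemeasurable
  have h3 := condLExp_mul_left (P := P) hm (hcm.pow_const (θ - 1)) hg
  filter_upwards [h1, h2, h3, ae_condLExp_ne_zero hm hg h0] with x h1 h2 h3 hx
  refine h1.trans ?_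
  rw [h2, Pi.add_apply, h3, condLExp_eq_self hm P (hcm.pow_const θ), ← hc, two_mul]
  gcongr
  rcases eq_or_ne (c x) ∞ with ht | ht
  · simp [ht, ENNReal.top_rpow_of_pos hθ0]
  · conv_lhs => enter [2]; rw [← ENNReal.rpow_one (c x)]
    rw [← ENNReal.rpow_add _ _ hx ht, sub_add_cancel]

end CondLExp

/-! ### Doob's inequality relative to a measure σ dP. -/

section WeightedDoob

variable {Ω : Type*} {mΩ : MeasurableSpace Ω}

/-- The Doob maximal function of a `[0,∞]`-valued function. -/
noncomputable def condMax (P : Measure Ω) (ℱ : Filtration ℕ mΩ) (f : Ω → ℝ≥0∞) (x : Ω) : ℝ≥0∞ :=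
  ⨆ n, condLExp (ℱ n) P f x

/-- The Doob maximal function with respect to the measure `σ dP`. -/
noncomputable def weightedMax (P : Measure Ω) (ℱ : Filtration ℕ mΩ) (σ G : Ω → ℝ≥0∞) (x : Ω) :
    ℝ≥0∞ :=
  ⨆ n, condLExp (ℱ n) P (fun y => G y * σ y) x / condLExp (ℱ n) P σ x

variable {P : Measure Ω} {ℱ : Filtration ℕ mΩ}

@[fun_prop]
lemma measurable_condMax (f : Ω → ℝ≥0∞) : Measurable (condMax P ℱ f) :=
  Measurable.iSup fun n => measurable_condLExp' (ℱ n) P f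

@[fun_prop]
lemma measurable_weightedMax (σ G : Ω → ℝ≥0∞) : Measurable (weightedMax P ℱ σ G) :=
  Measurable.iSup fun n => (measurable_condLExp' (ℱ n) P _).div (measurable_condLExp' (ℱ n) P σ)

/-- Stopping time: `disjointed A n` is the event that the level c is first exceeded at time n. It
lies in ℱ n, so the conditional expectations can be integrated away on it. -/
lemma weightedMax_weak_type [IsFiniteMeasure P] (σ G : Ω → ℝ≥0∞) (c : ℝ≥0∞) :
    c * ∫⁻ x in {x | c < weightedMax P ℱ σ G x}, σ x ∂P ≤
      ∫⁻ x in {x | c < weightedMax P ℱ σ G x}, G x * σ x ∂P := by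
  set A : ℕ → Set Ω := fun n =>
    {x | c < condLExp (ℱ n) P (fun y => G y * σ y) x / condLExp (ℱ n) P σ x} with hA
  have hAm : ∀ n, MeasurableSet[ℱ n] (A n) := fun n =>
    measurableSet_lt measurable_const
      ((measurable_condLExp (ℱ n) P _).div (measurable_condLExp (ℱ n) P σ))
  have hDm : ∀ n, MeasurableSet[ℱ n] (disjointed A n) := by
    intro n
    rw [disjointed_eq_inter_compl]
    refine (hAm n).inter ?_
    exact MeasurableSet.iInter fun i => MeasurableSet.iInter fun hi =>
      (ℱ.mono hi.le _ (hAm i)).compl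
  have hU : {x | c < weightedMax P ℱ σ G x} = ⋃ n, disjointed A n := by
    rw [iUnion_disjointed]
    ext x
    simp [hA, weightedMax, lt_iSup_iff]
  rw [hU, lintegral_iUnion (fun n => ℱ.le n _ (hDm n)) (disjoint_disjointed A),
    lintegral_iUnion (fun n => ℱ.le n _ (hDm n)) (disjoint_disjointed A), ← ENNReal.tsum_mul_left]
  refine ENNReal.tsum_le_tsum fun n => ?_
  rw [← setLIntegral_condLExp (ℱ.le n) P σ (hDm n),
    ← setLIntegral_condLExp (ℱ.le n) P (fun x => G x * σ x) (hDm n),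
    ← lintegral_const_mul _ (measurable_condLExp' _ _ _)]
  refine setLIntegral_mono' (ℱ.le n _ (hDm n)) fun x hx => ?_
  exact (ENNReal.mul_lt_of_lt_div (disjointed_subset A n hx)).le

lemma weightedMax_le_add {σ G : Ω → ℝ≥0∞} (hσ : Measurable σ) (hG : Measurable G) (c : ℝ≥0) :
    ∀ᵐ x ∂P, weightedMax P ℱ σ G x ≤
      weightedMax P ℱ σ ({x | (c : ℝ≥0∞) < G x}.indicator G) x + c := by
  set G₁ := {x | (c : ℝ≥0∞) < G x}.indicator G with hG₁
  have hG₁m : Measurable G₁ := hG.indicator (measurableSet_lt measurable_const hG)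
  have h1 : ∀ n, ∀ᵐ x ∂P, condLExp (ℱ n) P (fun y => G y * σ y) x ≤
      condLExp (ℱ n) P (fun y => G₁ y * σ y) x + c * condLExp (ℱ n) P σ x := by
    intro n
    have a := condLExp_mono (mΩ := ℱ n) (P := P) (X := fun y => G y * σ y)
      (Y := (fun y => G₁ y * σ y) + (c : ℝ≥0∞) • σ) <| by
        refine ae_of_all _ fun x => ?_
        simp only [Pi.add_apply, Pi.smul_apply, smul_eq_mul, ← add_mul, hG₁]
        gcongr
        by_cases h : (c : ℝ≥0∞) < G x
        · simp [h]
        · simpa [h] using not_lt.1 h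
    have b := condLExp_add_left (mΩ := ℱ n) (P := P) (X := fun y => G₁ y * σ y)
      ((c : ℝ≥0∞) • σ) (hG₁m.mul hσ).aemeasurable
    have d := condLExp_smul (mΩ := ℱ n) (P := P) σ hσ.aemeasurable (c : ℝ≥0∞)
    filter_upwards [a, b, d] with x a b d
    rw [b, Pi.add_apply, d] at a
    exact a
  filter_upwards [ae_all_iff.2 h1] with x hx
  refine iSup_le fun n => ?_
  calc _ ≤ (condLExp (ℱ n) P (fun y => G₁ y * σ y) x + c * condLExp (ℱ n) P σ x)
        / condLExp (ℱ n) P σ x := by gcongr; exact hx n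
    _ ≤ _ := by
        rw [ENNReal.add_div]
        gcongr
        · exact le_iSup (fun n => condLExp (ℱ n) P (fun y => G₁ y * σ y) x
            / condLExp (ℱ n) P σ x) n
        · exact ENNReal.div_le_of_le_mul le_rfl

lemma rpow_eq_rpow_sub_one_mul (x : ℝ≥0∞) {p : ℝ} (hp : 1 ≤ p) : x ^ p = x ^ (p - 1) * x := by
  conv_rhs => enter [2]; rw [← ENNReal.rpow_one x]
  rw [← ENNReal.rpow_add_of_nonneg _ _ (by linarith) zero_le_one, sub_add_cancel]

/-- A discrete layer-cake bound: for finite u > 0 the one k with 2·2^k < u ≤ 4·2^k suffices, and for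
u = ∞ the terms are unbounded. -/
lemma rpow_le_tsum_dyadic {p : ℝ} (hp : 0 < p) (u : ℝ≥0∞) :
    u ^ p ≤ ∑' k : ℤ, (if 2 * (dyadic k : ℝ≥0∞) < u then (4 * (dyadic k : ℝ≥0∞)) ^ p else 0) := by
  rcases eq_or_ne u 0 with rfl | h0
  · simp [ENNReal.zero_rpow_of_pos hp]
  rcases eq_or_ne u ∞ with rfl | ht
  · rw [tsum_eq_top_of_forall_exists_le]
    · exact le_top
    intro B
    have hlt : (2 : ℝ≥0∞) * ((B + 1 : ℝ≥0) ^ p⁻¹ : ℝ≥0) < ∞ := by finiteness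
    obtain ⟨k, -, hk⟩ := exists_dyadic_lt_le (u := ((B + 1 : ℝ≥0) ^ p⁻¹ : ℝ≥0))
      (by simp) (by simp)
    refine ⟨k, ?_⟩
    rw [if_pos (by finiteness)]
    calc (B : ℝ≥0∞) ≤ ((B + 1 : ℝ≥0) : ℝ≥0∞) := by exact_mod_cast le_self_add
      _ = (((B + 1 : ℝ≥0) ^ p⁻¹ : ℝ≥0) : ℝ≥0∞) ^ p := by
          rw [← ENNReal.coe_rpow_of_nonneg _ hp.le, ← NNReal.rpow_mul, inv_mul_cancel₀ hp.ne',
            NNReal.rpow_one]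
      _ ≤ _ := by
          refine ENNReal.rpow_le_rpow (hk.trans ?_) hp.le
          gcongr; norm_num
  · obtain ⟨k, hk1, hk2⟩ := exists_dyadic_lt_le (u := u / 2)
      (by simp [h0]) (by finiteness)
    refine le_trans ?_ (ENNReal.le_tsum k)
    rw [if_pos]
    · refine ENNReal.rpow_le_rpow ?_ hp.le
      rw [ENNReal.div_le_iff (by simp) (by simp)] at hk2
      calc u ≤ _ := hk2
        _ = _ := by ring
    · rw [mul_comm]; exact ENNReal.mul_lt_of_lt_div hk1

/-- Doob's maximal inequality with respect to the measure `σ dP`. -/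
theorem exists_weightedMax_strong_type (P : Measure Ω) [IsFiniteMeasure P] (ℱ : Filtration ℕ mΩ)
    {p : ℝ} (hp : 1 < p) : ∃ C : ℝ≥0, ∀ σ G : Ω → ℝ≥0∞, Measurable σ → Measurable G →
      ∫⁻ x, weightedMax P ℱ σ G x ^ p * σ x ∂P ≤ C * ∫⁻ x, G x ^ p * σ x ∂P := by
  obtain ⟨C, -, hC⟩ := exists_tsum_dyadic_le (sub_pos.2 hp)
  refine ⟨4 ^ p * C, fun σ G hσ hG => ?_⟩
  set N := weightedMax P ℱ σ G with hN
  have hNm : Measurable N := measurable_weightedMax σ G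
  -- Cutting G off below 2^k costs at most 2^k in the maximal function, so N > 2·2^k forces the
  -- maximal function of the upper part above 2^k, where the weak type applies.
  have hweak : ∀ k : ℤ, dyadic k * ∫⁻ x, (if 2 * (dyadic k : ℝ≥0∞) < N x then σ x else 0) ∂P ≤
      ∫⁻ x, (if (dyadic k : ℝ≥0∞) ≤ G x then G x * σ x else 0) ∂P := by
    intro k
    set G₁ := {x | (dyadic k : ℝ≥0∞) < G x}.indicator G with hG₁
    have hm : MeasurableSet {x | (dyadic k : ℝ≥0∞) < weightedMax P ℱ σ G₁ x} :=
      measurableSet_lt measurable_const (measurable_weightedMax σ G₁)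
    calc _ ≤ dyadic k * ∫⁻ x in {x | (dyadic k : ℝ≥0∞) < weightedMax P ℱ σ G₁ x}, σ x ∂P := by
          refine mul_le_mul_right ?_ _
          rw [← lintegral_indicator hm]
          refine lintegral_mono_ae ?_
          filter_upwards [weightedMax_le_add (P := P) (ℱ := ℱ) hσ hG (dyadic k)] with x hx
          split_ifs with h
          · rw [Set.indicator_of_mem]
            have := h.trans_le hx
            rw [two_mul] at this
            exact lt_of_add_lt_add_right this
          · exact zero_le
      _ ≤ ∫⁻ x in {x | (dyadic k : ℝ≥0∞) < weightedMax P ℱ σ G₁ x}, G₁ x * σ x ∂P :=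
          weightedMax_weak_type σ G₁ _
      _ ≤ ∫⁻ x, G₁ x * σ x ∂P := setLIntegral_le_lintegral _ _
      _ ≤ _ := by
          refine lintegral_mono fun x => ?_
          by_cases h : (dyadic k : ℝ≥0∞) < G x
          · simp [hG₁, h, h.le]
          · simp [hG₁, h]
  calc ∫⁻ x, N x ^ p * σ x ∂P
      ≤ ∫⁻ x, ∑' k : ℤ, (4 * (dyadic k : ℝ≥0∞)) ^ p *
          (if 2 * (dyadic k : ℝ≥0∞) < N x then σ x else 0) ∂P := by
        refine lintegral_mono fun x => ?_
        dsimp only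
        grw [rpow_le_tsum_dyadic (by linarith : 0 < p) (N x), ← ENNReal.tsum_mul_right]
        refine ENNReal.tsum_le_tsum fun k => ?_
        split_ifs <;> simp
    _ = ∑' k : ℤ, (4 * (dyadic k : ℝ≥0∞)) ^ p *
          ∫⁻ x, (if 2 * (dyadic k : ℝ≥0∞) < N x then σ x else 0) ∂P := by
        have hm : ∀ k : ℤ, Measurable fun x => if 2 * (dyadic k : ℝ≥0∞) < N x then σ x else 0 :=
          fun k => Measurable.ite (measurableSet_lt measurable_const hNm) hσ measurable_const
        rw [lintegral_tsum fun k => ((hm k).const_mul _).aemeasurable]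
        exact tsum_congr fun k => lintegral_const_mul _ (hm k)
    _ ≤ ∑' k : ℤ, 4 ^ p * (dyadic k : ℝ≥0∞) ^ (p - 1) *
          ∫⁻ x, (if (dyadic k : ℝ≥0∞) ≤ G x then G x * σ x else 0) ∂P := by
        refine ENNReal.tsum_le_tsum fun k => ?_
        grw [← hweak k]
        rw [ENNReal.mul_rpow_of_nonneg _ _ (by linarith),
          rpow_eq_rpow_sub_one_mul (dyadic k : ℝ≥0∞) hp.le]
        exact le_of_eq (by ring)
    _ = ∫⁻ x, ∑' k : ℤ, 4 ^ p * (dyadic k : ℝ≥0∞) ^ (p - 1) *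
          (if (dyadic k : ℝ≥0∞) ≤ G x then G x * σ x else 0) ∂P := by
        have hm : ∀ k : ℤ, Measurable fun x => if (dyadic k : ℝ≥0∞) ≤ G x then G x * σ x else 0 :=
          fun k => Measurable.ite (measurableSet_le measurable_const hG) (hG.mul hσ)
            measurable_const
        rw [lintegral_tsum fun k => ((hm k).const_mul _).aemeasurable]
        exact tsum_congr fun k => (lintegral_const_mul _ (hm k)).symm
    _ ≤ ∫⁻ x, ((4 ^ p * C : ℝ≥0) : ℝ≥0∞) * (G x ^ p * σ x) ∂P := by
        refine lintegral_mono fun x => ?_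
        calc _ = 4 ^ p * (G x * σ x) * ∑' k : ℤ,
              (if (dyadic k : ℝ≥0∞) ≤ G x then (dyadic k : ℝ≥0∞) ^ (p - 1) else 0) := by
              rw [← ENNReal.tsum_mul_left]
              refine tsum_congr fun k => ?_
              split_ifs <;> ring
          _ ≤ 4 ^ p * (G x * σ x) * (C * G x ^ (p - 1)) := by gcongr; exact hC _
          _ = _ := by
              rw [rpow_eq_rpow_sub_one_mul (G x) hp.le, ENNReal.coe_mul, ENNReal.coe_rpow_of_nonneg _ (by linarith : 0 ≤ p)]
              push_cast
              ring
    _ = _ := lintegral_const_mul' _ _ ENNReal.coe_ne_top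

end WeightedDoob

/-! ### The Doob maximal operator on L^p(w) for w ∈ A_p. -/

section Buckley

variable {Ω : Type*} {mΩ : MeasurableSpace Ω}

/-- A Muckenhoupt weight `w` of class `A_p` with constant `K`, together with its dual weight
`σ = w ^ (-1 / (p - 1))`. -/
structure IsMuckenhouptPair (P : Measure Ω) (ℱ : Filtration ℕ mΩ) (p : ℝ) (K : ℝ≥0)
    (w σ : Ω → ℝ≥0∞) : Prop where
  measurable_left : Measurable w
  measurable_right : Measurable σ
  dual : ∀ᵐ x ∂P, σ x ^ (p - 1) * w x = 1
  bound : ∀ n, ∀ᵐ x ∂P, condLExp (ℱ n) P w x * condLExp (ℱ n) P σ x ^ (p - 1) ≤ K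

lemma ne_zero_ne_top_of_rpow_mul_eq_one {s w : ℝ≥0∞} {a : ℝ} (ha : 0 < a) (h : s ^ a * w = 1) :
    (s ≠ 0 ∧ s ≠ ∞) ∧ w ≠ 0 ∧ w ≠ ∞ := by
  refine ⟨⟨?_, ?_⟩, ?_, ?_⟩ <;> rintro rfl
  · simp [ENNReal.zero_rpow_of_pos ha] at h
  · rw [ENNReal.top_rpow_of_pos ha] at h
    rcases eq_or_ne w 0 with rfl | hw <;> simp_all [ENNReal.top_mul]
  · simp at h
  · rcases eq_or_ne (s ^ a) 0 with h0 | h0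
    · simp [h0] at h
    · simp [ENNReal.mul_top h0] at h

lemma rpow_mul_eq_one_symm {p q : ℝ} (hpq : p.HolderConjugate q) {s w : ℝ≥0∞}
    (h : s ^ (p - 1) * w = 1) : w ^ (q - 1) * s = 1 := by
  have h1 : (p - 1) * (q - 1) = 1 := by linarith [hpq.sub_one_mul_conj]
  calc w ^ (q - 1) * s = (s ^ (p - 1) * w) ^ (q - 1) := by
        rw [ENNReal.mul_rpow_of_nonneg _ _ hpq.symm.sub_one_pos.le, ← ENNReal.rpow_mul, h1,
          ENNReal.rpow_one, mul_comm]
    _ = 1 := by rw [h, ENNReal.one_rpow]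

/-- Division by the dual weight is thus an isometry from L^p(w) to L^p(σ). -/
lemma div_rpow_mul_eq {p : ℝ} (hp : 1 < p) {s w : ℝ≥0∞} (h : s ^ (p - 1) * w = 1) (a : ℝ≥0∞) :
    (a / s) ^ p * s = a ^ p * w := by
  obtain ⟨⟨hs0, hst⟩, -⟩ := ne_zero_ne_top_of_rpow_mul_eq_one (sub_pos.2 hp) h
  have hw : w = (s ^ (p - 1))⁻¹ := ENNReal.eq_inv_of_mul_eq_one_left (by rwa [mul_comm])
  have hsp0 : s ^ (p - 1) ≠ 0 := (ENNReal.rpow_pos (pos_iff_ne_zero.2 hs0) hst).ne'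
  rw [ENNReal.div_rpow_of_nonneg _ _ (by linarith), hw, div_eq_mul_inv, mul_assoc,
    rpow_eq_rpow_sub_one_mul s hp.le, ENNReal.mul_inv (Or.inl hsp0) (Or.inr hs0), mul_assoc,
    ENNReal.inv_mul_cancel hs0 hst, mul_one]

variable {P : Measure Ω} {ℱ : Filtration ℕ mΩ} {p q : ℝ} {K : ℝ≥0} {w σ : Ω → ℝ≥0∞}

lemma IsMuckenhouptPair.symm (h : IsMuckenhouptPair P ℱ p K w σ) (hpq : p.HolderConjugate q) :
    IsMuckenhouptPair P ℱ q (K ^ (q - 1)) σ w where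
  measurable_left := h.measurable_right
  measurable_right := h.measurable_left
  dual := h.dual.mono fun _ hx => rpow_mul_eq_one_symm hpq hx
  bound n := by
    have h1 : (p - 1) * (q - 1) = 1 := by linarith [hpq.sub_one_mul_conj]
    have h2 : 0 ≤ q - 1 := hpq.symm.sub_one_pos.le
    filter_upwards [h.bound n] with x hx
    calc _ = (condLExp (ℱ n) P w x * condLExp (ℱ n) P σ x ^ (p - 1)) ^ (q - 1) := by
          rw [ENNReal.mul_rpow_of_nonneg _ _ h2, ← ENNReal.rpow_mul, h1, ENNReal.rpow_one, mul_comm]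
      _ ≤ (K : ℝ≥0∞) ^ (q - 1) := ENNReal.rpow_le_rpow hx h2
      _ = _ := by rw [ENNReal.coe_rpow_of_nonneg _ h2]

/-- Write E_n f = ρ E_n σ, where ρ is ℱ n-measurable and at most N, the σ-maximal function of f/σ.
Then A_p gives (E_n f)^(p-1) E_n w ≤ K ρ^(p-1) ≤ K E_n(N^(p-1)). Dividing by E_n w leaves an average
relative to w dP, and the power q gives the claim since (p-1)q = p. -/
lemma IsMuckenhouptPair.condMax_rpow_le [IsFiniteMeasure P] (h : IsMuckenhouptPair P ℱ p K w σ)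
    (hpq : p.HolderConjugate q) (f : Ω → ℝ≥0∞) :
    ∀ᵐ x ∂P, condMax P ℱ f x ^ p ≤ (K * weightedMax P ℱ w
      (fun y => weightedMax P ℱ σ (fun z => f z / σ z) y ^ (p - 1) / w y) x) ^ q := by
  have hp1 : 0 < p - 1 := hpq.sub_one_pos
  set G : Ω → ℝ≥0∞ := fun z => f z / σ z with hG
  set N := weightedMax P ℱ σ G with hN
  set H : Ω → ℝ≥0∞ := fun y => N y ^ (p - 1) / w y with hH
  have hne := h.dual.mono fun x hx => ne_zero_ne_top_of_rpow_mul_eq_one hp1 hx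
  have hfG : (fun y => G y * σ y) =ᵐ[P] f := by
    filter_upwards [hne] with x hx using ENNReal.div_mul_cancel hx.1.1 hx.1.2
  have key : ∀ n, ∀ᵐ x ∂P, condLExp (ℱ n) P f x ^ p ≤ (K * weightedMax P ℱ w H x) ^ q := by
    intro n
    have hle := ℱ.le n
    set ρ : Ω → ℝ≥0∞ := fun x => condLExp (ℱ n) P (fun y => G y * σ y) x / condLExp (ℱ n) P σ x
      with hρ
    have hρm : Measurable[ℱ n] ρ :=
      (measurable_condLExp (ℱ n) P _).div (measurable_condLExp (ℱ n) P σ)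
    have h1 : ∀ᵐ x ∂P, ρ x ^ (p - 1) ≤ condLExp (ℱ n) P (fun y => H y * w y) x := by
      have := condLExp_mono (mΩ := ℱ n) (P := P) (X := fun x => ρ x ^ (p - 1))
        (Y := fun y => H y * w y) <| by
          filter_upwards [hne] with x hx
          simp only [hH]
          rw [ENNReal.div_mul_cancel hx.2.1 hx.2.2]
          exact ENNReal.rpow_le_rpow (le_iSup (fun n => condLExp (ℱ n) P (fun y => G y * σ y) x /
            condLExp (ℱ n) P σ x) n) hp1.le
      rwa [condLExp_eq_self hle P (hρm.pow_const _)] at this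
    filter_upwards [h1, condLExp_congr_ae (mΩ := ℱ n) hfG, h.bound n,
      ae_condLExp_ne_zero hle h.measurable_left (hne.mono fun _ hx => hx.2.1),
      ae_condLExp_ne_zero hle h.measurable_right (hne.mono fun _ hx => hx.1.1)]
      with x h1 hfx hK hw0 hσ0
    have hwt : condLExp (ℱ n) P w x ≠ ∞ := by
      intro ht
      rw [ht, ENNReal.top_mul] at hK
      · exact absurd hK (by simp)
      · exact (ENNReal.rpow_pos_of_nonneg (pos_iff_ne_zero.2 hσ0) hp1.le).ne'
    have hσt : condLExp (ℱ n) P σ x ≠ ∞ := by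
      intro ht
      rw [ht, ENNReal.top_rpow_of_pos hp1, ENNReal.mul_top hw0] at hK
      exact absurd hK (by simp)
    have e1 : condLExp (ℱ n) P f x = ρ x * condLExp (ℱ n) P σ x := by
      rw [hρ, ← hfx]; exact (ENNReal.div_mul_cancel hσ0 hσt).symm
    have e2 : condLExp (ℱ n) P f x ^ (p - 1) * condLExp (ℱ n) P w x ≤
        K * condLExp (ℱ n) P (fun y => H y * w y) x := by
      rw [e1, ENNReal.mul_rpow_of_nonneg _ _ hp1.le]
      calc _ = (condLExp (ℱ n) P w x * condLExp (ℱ n) P σ x ^ (p - 1)) * ρ x ^ (p - 1) := by ring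
        _ ≤ _ := mul_le_mul' hK h1
    have e3 : condLExp (ℱ n) P f x ^ (p - 1) ≤ K * weightedMax P ℱ w H x := by
      rw [← ENNReal.le_div_iff_mul_le (Or.inl hw0) (Or.inl hwt), mul_div_assoc] at e2
      refine e2.trans (mul_le_mul_right ?_ _)
      exact le_iSup (fun n => condLExp (ℱ n) P (fun y => H y * w y) x / condLExp (ℱ n) P w x) n
    calc condLExp (ℱ n) P f x ^ p = (condLExp (ℱ n) P f x ^ (p - 1)) ^ q := by
          rw [← ENNReal.rpow_mul, hpq.sub_one_mul_conj]
      _ ≤ _ := ENNReal.rpow_le_rpow e3 hpq.symm.nonneg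
  filter_upwards [ae_all_iff.2 key] with x hx
  rw [← ENNReal.le_rpow_inv_iff hpq.pos]
  exact iSup_le fun n => (ENNReal.le_rpow_inv_iff hpq.pos).2 (hx n)

/-- Buckley's theorem: Doob's maximal operator is bounded on `L^p(w)` for every Muckenhoupt weight
`w` of class `A_p`, for an arbitrary filtration. -/
theorem exists_condMax_strong_type (P : Measure Ω) [IsFiniteMeasure P] (ℱ : Filtration ℕ mΩ)
    (hp : 1 < p) (K : ℝ≥0) : ∃ C : ℝ≥0, ∀ w σ : Ω → ℝ≥0∞, IsMuckenhouptPair P ℱ p K w σ →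
      ∀ f : Ω → ℝ≥0∞, Measurable f →
        ∫⁻ x, condMax P ℱ f x ^ p * w x ∂P ≤ C * ∫⁻ x, f x ^ p * w x ∂P := by
  have hpq := Real.HolderConjugate.conjExponent hp
  set q := p.conjExponent
  obtain ⟨C₁, h₁⟩ := exists_weightedMax_strong_type P ℱ hp
  obtain ⟨C₂, h₂⟩ := exists_weightedMax_strong_type P ℱ hpq.symm.lt
  refine ⟨K ^ q * (C₂ * C₁), fun w σ h f hf => ?_⟩
  set G : Ω → ℝ≥0∞ := fun z => f z / σ z with hG
  have hGm : Measurable G := hf.div h.measurable_right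
  set N := weightedMax P ℱ σ G with hN
  set H : Ω → ℝ≥0∞ := fun y => N y ^ (p - 1) / w y with hH
  have hHm : Measurable H := ((measurable_weightedMax σ G).pow_const _).div h.measurable_left
  calc ∫⁻ x, condMax P ℱ f x ^ p * w x ∂P
      ≤ ∫⁻ x, ((K ^ q : ℝ≥0) : ℝ≥0∞) * (weightedMax P ℱ w H x ^ q * w x) ∂P := by
        refine lintegral_mono_ae ?_
        filter_upwards [h.condMax_rpow_le hpq f] with x hx
        rw [ENNReal.mul_rpow_of_nonneg _ _ hpq.symm.nonneg] at hx
        rw [ENNReal.coe_rpow_of_nonneg _ hpq.symm.nonneg, ← mul_assoc]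
        exact mul_le_mul_left hx _
    _ ≤ ((K ^ q : ℝ≥0) : ℝ≥0∞) * (C₂ * ∫⁻ x, H x ^ q * w x ∂P) := by
        rw [lintegral_const_mul' _ _ ENNReal.coe_ne_top]
        gcongr
        exact h₂ w H h.measurable_left hHm
    _ = ((K ^ q : ℝ≥0) : ℝ≥0∞) * (C₂ * ∫⁻ x, N x ^ p * σ x ∂P) := by
        congr 2
        refine lintegral_congr_ae ?_
        filter_upwards [h.dual] with x hx
        simp only [hH]
        rw [div_rpow_mul_eq hpq.symm.lt (rpow_mul_eq_one_symm hpq hx), ← ENNReal.rpow_mul,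
          hpq.sub_one_mul_conj]
    _ ≤ ((K ^ q : ℝ≥0) : ℝ≥0∞) * (C₂ * (C₁ * ∫⁻ x, G x ^ p * σ x ∂P)) := by
        gcongr
        exact h₁ σ G h.measurable_right hGm
    _ = ((K ^ q : ℝ≥0) : ℝ≥0∞) * (C₂ * (C₁ * ∫⁻ x, f x ^ p * w x ∂P)) := by
        congr 3
        refine lintegral_congr_ae ?_
        filter_upwards [h.dual] with x hx using div_rpow_mul_eq hp hx _
    _ = _ := by push_cast; ring

end Buckley

/-! ### The Rubio de Francia iteration and A_r weights built from A_1 weights. -/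

section Extrapolation

variable {Ω : Type*} {mΩ : MeasurableSpace Ω} {P : Measure Ω} {ℱ : Filtration ℕ mΩ}

lemma lintegral_iterate_condMax_le {p : ℝ} {A : ℝ≥0} {w : Ω → ℝ≥0∞}
    (hA : ∀ f : Ω → ℝ≥0∞, Measurable f →
      ∫⁻ x, condMax P ℱ f x ^ p * w x ∂P ≤ A * ∫⁻ x, f x ^ p * w x ∂P)
    {g : Ω → ℝ≥0∞} (hg : Measurable g) (k : ℕ) :
    Measurable ((condMax P ℱ)^[k] g) ∧
    ∫⁻ x, (condMax P ℱ)^[k] g x ^ p * w x ∂P ≤ (A : ℝ≥0∞) ^ k * ∫⁻ x, g x ^ p * w x ∂P := by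
  induction k with
  | zero => simpa using hg
  | succ k ih =>
    rw [Function.iterate_succ', Function.comp_apply]
    refine ⟨measurable_condMax _, (hA _ ih.1).trans ?_⟩
    rw [pow_succ', mul_assoc]
    gcongr
    exact ih.2

lemma iSup_rpow_le_tsum {p : ℝ} (hp : 0 < p) (x : ℕ → ℝ≥0∞) : (⨆ k, x k) ^ p ≤ ∑' k, x k ^ p := by
  rw [← ENNReal.le_rpow_inv_iff hp]
  exact iSup_le fun k => (ENNReal.le_rpow_inv_iff hp).2 (ENNReal.le_tsum (f := fun k => x k ^ p) k)

/-- The Rubio de Francia algorithm. -/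
theorem exists_rubioDeFrancia (P : Measure Ω) [IsFiniteMeasure P] (ℱ : Filtration ℕ mΩ)
    {p : ℝ} (hp : 1 < p) (K : ℝ≥0) : ∃ C D : ℝ≥0, 0 < D ∧ ∀ w σ : Ω → ℝ≥0∞,
      IsMuckenhouptPair P ℱ p K w σ → ∀ g : Ω → ℝ≥0∞, Measurable g →
        ∃ a : Ω → ℝ≥0∞, Measurable a ∧ (∀ x, g x ≤ a x) ∧
          ∫⁻ x, a x ^ p * w x ∂P ≤ C * ∫⁻ x, g x ^ p * w x ∂P ∧
          ∀ n, ∀ᵐ x ∂P, condLExp (ℱ n) P a x ≤ D * a x := by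
  obtain ⟨A, hA⟩ := exists_condMax_strong_type P ℱ hp K
  have hp0 : 0 < p := by linarith
  -- Here A bounds the p-th power of the operator norm. E ≥ 1 gives E^(-p) ≤ E^(-1), and E ≥ 2A then
  -- makes E^(-p) A ≤ 1/2.
  set E : ℝ≥0 := 2 * A + 2 with hE
  have hE1 : 1 ≤ E := by rw [hE]; exact le_add_left (by norm_num)
  have hE0 : 0 < E := one_pos.trans_le hE1
  have hEA : (E⁻¹ : ℝ≥0) ^ p * A ≤ 2⁻¹ := by
    calc (E⁻¹ : ℝ≥0) ^ p * A ≤ E⁻¹ ^ (1 : ℝ) * A := by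
          gcongr ?_ * _
          exact NNReal.rpow_le_rpow_of_exponent_ge (inv_pos.2 hE0) (inv_le_one_of_one_le₀ hE1) hp.le
      _ ≤ 2⁻¹ := by
          rw [NNReal.rpow_one, inv_mul_le_iff₀ hE0, hE, add_mul, mul_comm 2 A, mul_assoc]
          simp
  refine ⟨2 ^ p * 2, 2 * E, by positivity, fun w σ h g hg => ?_⟩
  have hM := lintegral_iterate_condMax_le (hA w σ h) hg
  set M : ℕ → Ω → ℝ≥0∞ := fun k => (condMax P ℱ)^[k] g with hMdef
  set c : ℕ → ℝ≥0 := fun k => ((2 * E)⁻¹) ^ k with hc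
  have hMm : ∀ k, Measurable (M k) := fun k => (hM k).1
  refine ⟨fun x => ∑' k, c k * M k x, by fun_prop, fun x => ?_, ?_, fun n => ?_⟩
  · refine le_trans ?_ (ENNReal.le_tsum 0)
    simp [hc, hMdef]
  -- The spare factor 2^(-k) bounds the series by twice a supremum, whose p-th power is at most the
  -- sum of the p-th powers. This replaces Minkowski's inequality.
  · have hpt : ∀ x, (∑' k, (c k : ℝ≥0∞) * M k x) ^ p ≤
        2 ^ p * ∑' k, (((E⁻¹ : ℝ≥0) : ℝ≥0∞) ^ k * M k x) ^ p := by
      intro x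
      calc _ ≤ (2 * ⨆ k, ((E⁻¹ : ℝ≥0) : ℝ≥0∞) ^ k * M k x) ^ p := by
            refine ENNReal.rpow_le_rpow ?_ hp0.le
            calc _ ≤ ∑' k : ℕ, (2⁻¹ : ℝ≥0∞) ^ k * ⨆ k, ((E⁻¹ : ℝ≥0) : ℝ≥0∞) ^ k * M k x := by
                  refine ENNReal.tsum_le_tsum fun k => ?_
                  have : (c k : ℝ≥0∞) = 2⁻¹ ^ k * ((E⁻¹ : ℝ≥0) : ℝ≥0∞) ^ k := by
                    simp only [hc]
                    rw [mul_inv, mul_pow]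
                    push_cast
                    rfl
                  rw [this, mul_assoc]
                  gcongr
                  exact le_iSup (fun k => ((E⁻¹ : ℝ≥0) : ℝ≥0∞) ^ k * M k x) k
              _ = _ := by
                  rw [ENNReal.tsum_mul_right, ENNReal.tsum_geometric, ENNReal.one_sub_inv_two,
                    inv_inv]
        _ ≤ _ := by
            rw [ENNReal.mul_rpow_of_nonneg _ _ hp0.le]
            gcongr
            exact iSup_rpow_le_tsum hp0 _
    calc _ ≤ ∫⁻ x, 2 ^ p * ∑' k, (((E⁻¹ : ℝ≥0) : ℝ≥0∞) ^ k) ^ p * (M k x ^ p * w x) ∂P := by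
          refine lintegral_mono fun x => ?_
          dsimp only
          grw [hpt x, mul_assoc, ← ENNReal.tsum_mul_right]
          refine mul_le_mul_right (ENNReal.tsum_le_tsum fun k => ?_) _
          rw [ENNReal.mul_rpow_of_nonneg _ _ hp0.le, mul_assoc]
      _ = 2 ^ p * ∑' k, (((E⁻¹ : ℝ≥0) : ℝ≥0∞) ^ k) ^ p * ∫⁻ x, M k x ^ p * w x ∂P := by
          have hw := h.measurable_left
          rw [lintegral_const_mul _ (by fun_prop), lintegral_tsum (by fun_prop)]
          congr 1
          exact tsum_congr fun k => lintegral_const_mul _ (by fun_prop)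
      _ ≤ 2 ^ p * ∑' k : ℕ, (2⁻¹ : ℝ≥0∞) ^ k * ∫⁻ x, g x ^ p * w x ∂P := by
          refine mul_le_mul_right (ENNReal.tsum_le_tsum fun k => ?_) _
          grw [(hM k).2]
          rw [← mul_assoc]
          gcongr
          rw [← ENNReal.rpow_natCast, ← ENNReal.rpow_mul, mul_comm (k : ℝ), ENNReal.rpow_mul,
            ENNReal.rpow_natCast, ← mul_pow]
          gcongr
          have := ENNReal.coe_le_coe.2 hEA
          rw [ENNReal.coe_mul, ENNReal.coe_rpow_of_nonneg _ hp0.le] at this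
          refine this.trans ?_
          simp
      _ = _ := by
          rw [ENNReal.tsum_mul_right, ENNReal.tsum_geometric, ENNReal.one_sub_inv_two, inv_inv,
            ENNReal.coe_mul, ENNReal.coe_rpow_of_nonneg _ hp0.le, mul_assoc]
          rfl
  -- Averaging the k-th iterate is dominated by the next one, so the series is shifted by one index
  -- at the price of the ratio 2E of consecutive coefficients.
  · have h1 := condLExp_tsum (P := P) (ℱ n) (X := fun k => (c k : ℝ≥0∞) • M k)
      (fun k => ((hMm k).const_smul _).aemeasurable)
    have h2 := fun k => condLExp_smul (mΩ := ℱ n) (P := P) (M k) (hMm k).aemeasurable (c k : ℝ≥0∞)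
    filter_upwards [h1, ae_all_iff.2 h2] with x h1 h2
    have e : (fun x => ∑' k, (c k : ℝ≥0∞) * M k x) = ∑' k, (c k : ℝ≥0∞) • M k := by
      ext x; simp [ENNReal.tsum_apply]
    rw [e, h1, ENNReal.tsum_apply]
    calc _ ≤ ∑' k, ((2 * E : ℝ≥0) : ℝ≥0∞) * (c (k + 1) * M (k + 1) x) := by
          refine ENNReal.tsum_le_tsum fun k => ?_
          rw [h2 k, ← mul_assoc, ← ENNReal.coe_mul]
          have hck : 2 * E * c (k + 1) = c k := by
            simp only [hc]
            rw [pow_succ', ← mul_assoc, mul_inv_cancel₀ (by positivity), one_mul]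
          rw [hck, Pi.smul_apply, smul_eq_mul]
          gcongr
          simp only [hMdef]
          rw [Function.iterate_succ', Function.comp_apply]
          exact le_iSup (fun n => condLExp (ℱ n) P ((condMax P ℱ)^[k] g) x) n
      _ ≤ _ := by
          rw [ENNReal.tsum_mul_left]
          exact mul_le_mul_right (ENNReal.tsum_comp_le_tsum_of_injective (add_left_injective 1)
            (fun k => (c k : ℝ≥0∞) * M k x)) _

lemma rpow_neg_le_of_le_mul {D : ℝ≥0} (hD : 0 < D) {s : ℝ} (hs : 0 ≤ s) {x a : ℝ≥0∞}
    (h : x ≤ D * a) : a ^ (-s) ≤ (D : ℝ≥0∞) ^ s * x ^ (-s) := by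
  have hD0 : (D : ℝ≥0∞) ≠ 0 := by exact_mod_cast hD.ne'
  have h1 : (D : ℝ≥0∞)⁻¹ * x ≤ a := by
    rw [mul_comm, ← div_eq_mul_inv]
    exact ENNReal.div_le_of_le_mul' h
  calc a ^ (-s) = (a ^ s)⁻¹ := ENNReal.rpow_neg _ _
    _ ≤ (((D : ℝ≥0∞)⁻¹ * x) ^ s)⁻¹ := ENNReal.inv_le_inv.2 (ENNReal.rpow_le_rpow h1 hs)
    _ = _ := by
      rw [ENNReal.mul_rpow_of_nonneg _ _ hs, ENNReal.inv_rpow, ENNReal.mul_inv, inv_inv,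
        ENNReal.rpow_neg]
      · left; simp [hs]
      · left
        rw [ENNReal.inv_ne_top]
        exact (ENNReal.rpow_pos (pos_iff_ne_zero.2 hD0) ENNReal.coe_ne_top).ne'

/-- The A_1 bound allows a^(-s) to be replaced by (E_n a)^(-s), which comes out of E_n. -/
lemma condLExp_rpow_neg_mul_le [IsFiniteMeasure P] {a b : Ω → ℝ≥0∞}
    (hb : Measurable b) {D : ℝ≥0} (hD : 0 < D) {s : ℝ} (hs : 0 ≤ s) (n : ℕ)
    (h : ∀ᵐ x ∂P, condLExp (ℱ n) P a x ≤ D * a x) :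
    ∀ᵐ x ∂P, condLExp (ℱ n) P (fun y => a y ^ (-s) * b y) x ≤
      (D : ℝ≥0∞) ^ s * condLExp (ℱ n) P a x ^ (-s) * condLExp (ℱ n) P b x := by
  have hm : Measurable[ℱ n] (fun x => (D : ℝ≥0∞) ^ s * condLExp (ℱ n) P a x ^ (-s)) :=
    ((measurable_condLExp (ℱ n) P a).pow_const _).const_mul _
  have h1 := condLExp_mono (mΩ := ℱ n) (P := P) (X := fun y => a y ^ (-s) * b y)
    (Y := fun y => (D : ℝ≥0∞) ^ s * condLExp (ℱ n) P a y ^ (-s) * b y) <| by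
      filter_upwards [h] with x hx
      exact mul_le_mul_left (rpow_neg_le_of_le_mul hD hs hx) _
  filter_upwards [h1, condLExp_mul_left (P := P) (ℱ.le n) hm hb] with x h1 h2
  rwa [h2] at h1

/-- The easy half of the factorization of `A_r` weights into `A_1` weights. -/
lemma isMuckenhouptPair_of_factors [IsFiniteMeasure P] {r r' : ℝ} (hr : r.HolderConjugate r')
    {a b : Ω → ℝ≥0∞}
    (ha : Measurable a) (hb : Measurable b) (ha0 : ∀ᵐ x ∂P, a x ≠ 0 ∧ a x ≠ ∞)
    (hb0 : ∀ᵐ x ∂P, b x ≠ 0 ∧ b x ≠ ∞) {D₁ D₂ : ℝ≥0} (hD₁ : 0 < D₁) (hD₂ : 0 < D₂)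
    (h₁ : ∀ n, ∀ᵐ x ∂P, condLExp (ℱ n) P a x ≤ D₁ * a x)
    (h₂ : ∀ n, ∀ᵐ x ∂P, condLExp (ℱ n) P b x ≤ D₂ * b x) :
    IsMuckenhouptPair P ℱ r (D₁ ^ (r - 1) * D₂) (fun x => a x ^ (-(r - 1)) * b x)
      (fun x => b x ^ (-(r' - 1)) * a x) where
  measurable_left := by fun_prop
  measurable_right := by fun_prop
  dual := by
    have hr1 : (r' - 1) * (r - 1) = 1 := by linarith [hr.sub_one_mul_conj]
    filter_upwards [ha0, hb0] with x ha hb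
    rw [ENNReal.mul_rpow_of_nonneg _ _ hr.sub_one_pos.le, ← ENNReal.rpow_mul, neg_mul, hr1]
    calc _ = (b x ^ (-1 : ℝ) * b x) * (a x ^ (r - 1) * a x ^ (-(r - 1))) := by ring
      _ = 1 := by
        rw [← ENNReal.rpow_add _ _ ha.1 ha.2, ENNReal.rpow_neg_one,
          ENNReal.inv_mul_cancel hb.1 hb.2]
        simp
  bound n := by
    have hr1 : (r' - 1) * (r - 1) = 1 := by linarith [hr.sub_one_mul_conj]
    filter_upwards [condLExp_rpow_neg_mul_le hb hD₁ hr.sub_one_pos.le n (h₁ n),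
      condLExp_rpow_neg_mul_le ha hD₂ hr.symm.sub_one_pos.le n (h₂ n)] with x k₁ k₂
    set A := condLExp (ℱ n) P a x
    set B := condLExp (ℱ n) P b x
    calc _ ≤ ((D₁ : ℝ≥0∞) ^ (r - 1) * A ^ (-(r - 1)) * B) *
          ((D₂ : ℝ≥0∞) ^ (r' - 1) * B ^ (-(r' - 1)) * A) ^ (r - 1) :=
          mul_le_mul' k₁ (ENNReal.rpow_le_rpow k₂ hr.sub_one_pos.le)
      _ = ((D₁ : ℝ≥0∞) ^ (r - 1) * D₂) * ((A ^ (r - 1) * (A ^ (r - 1))⁻¹) * (B * B⁻¹)) := by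
          rw [ENNReal.mul_rpow_of_nonneg _ _ hr.sub_one_pos.le,
            ENNReal.mul_rpow_of_nonneg _ _ hr.sub_one_pos.le, ← ENNReal.rpow_mul,
            ← ENNReal.rpow_mul, neg_mul, hr1, ENNReal.rpow_one, ENNReal.rpow_neg_one,
            ENNReal.rpow_neg]
          ring
      -- Only x·x⁻¹ ≤ 1 is needed, so the values 0 and ∞ of A and B do no harm.
      _ ≤ ((D₁ : ℝ≥0∞) ^ (r - 1) * D₂) * (1 * 1) := by
          gcongr <;> exact ENNReal.mul_inv_le_one _
      _ = _ := by
          rw [ENNReal.coe_mul, ENNReal.coe_rpow_of_nonneg _ hr.sub_one_pos.le]; ring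

end Extrapolation

/-! ### Rubio de Francia extrapolation. -/

section Extrapolation

variable {Ω : Type*} {mΩ : MeasurableSpace Ω}

/-- Absorption: a finite nonzero X allows division by X^(1/q). -/
lemma le_of_le_mul_rpow_mul_rpow {p q : ℝ} (hpq : p.HolderConjugate q) {X A c : ℝ≥0∞}
    (hX : X ≠ ∞) (h : X ≤ c * (A ^ (1 / p) * X ^ (1 / q))) : X ≤ c ^ p * A := by
  rcases eq_or_ne X 0 with rfl | hX0
  · exact zero_le
  have hXq : X ^ (1 / q) ≠ 0 := (ENNReal.rpow_pos (pos_iff_ne_zero.2 hX0) hX).ne'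
  have hXq' : X ^ (1 / q) ≠ ∞ :=
    ENNReal.rpow_ne_top_of_nonneg (by simpa using hpq.symm.nonneg) hX
  have hsplit : X = X ^ (1 / p) * X ^ (1 / q) := by
    rw [← ENNReal.rpow_add _ _ hX0 hX, one_div, one_div, hpq.inv_add_inv_eq_one, ENNReal.rpow_one]
  have h1 : X ^ (1 / p) ≤ c * A ^ (1 / p) := by
    rw [← ENNReal.mul_le_mul_iff_left hXq hXq', mul_assoc]
    exact hsplit ▸ h
  calc X = (X ^ (1 / p)) ^ p := by
        rw [← ENNReal.rpow_mul, one_div_mul_cancel hpq.ne_zero, ENNReal.rpow_one]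
    _ ≤ (c * A ^ (1 / p)) ^ p := ENNReal.rpow_le_rpow h1 hpq.nonneg
    _ = _ := by
        rw [ENNReal.mul_rpow_of_nonneg _ _ hpq.nonneg, ← ENNReal.rpow_mul,
          one_div_mul_cancel hpq.ne_zero, ENNReal.rpow_one]

lemma ae_ne_top_of_lintegral_rpow_mul_ne_top {P : Measure Ω} {p : ℝ} (hp : 0 < p)
    {a w : Ω → ℝ≥0∞} (ha : Measurable a) (hw : Measurable w) (hw0 : ∀ᵐ x ∂P, w x ≠ 0)
    (h : ∫⁻ x, a x ^ p * w x ∂P ≠ ∞) : ∀ᵐ x ∂P, a x ≠ ∞ := by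
  filter_upwards [ae_lt_top (by fun_prop) h, hw0] with x h1 h2 h3
  rw [h3, ENNReal.top_rpow_of_pos hp, ENNReal.top_mul h2] at h1
  exact absurd h1 (lt_irrefl _)

/-- Hölder after factoring U b as U (a^(-(r-1)) b)^(1/r) times (a b)^(1/r'). The hypothesis bounds
the first factor, and F ≤ a reduces F^r a^(-(r-1)) to a. -/
lemma lintegral_mul_le_of_factors {P : Measure Ω} {r r' : ℝ} (hr : r.HolderConjugate r')
    {U F a b : Ω → ℝ≥0∞} (hU : Measurable U) (ha : Measurable a) (hb : Measurable b)
    (ha0 : ∀ᵐ x ∂P, a x ≠ 0 ∧ a x ≠ ∞) (hb0 : ∀ᵐ x ∂P, b x ≠ 0 ∧ b x ≠ ∞)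
    (hFa : ∀ x, F x ≤ a x) {C : ℝ≥0}
    (h : ∫⁻ x, U x ^ r * (a x ^ (-(r - 1)) * b x) ∂P ≤
      C * ∫⁻ x, F x ^ r * (a x ^ (-(r - 1)) * b x) ∂P) :
    ∫⁻ x, U x * b x ∂P ≤ (C : ℝ≥0∞) ^ (1 / r) * ∫⁻ x, a x * b x ∂P := by
  have hr0 : 0 ≤ 1 / r := by simpa using hr.nonneg
  have hr0' : 0 ≤ 1 / r' := by simpa using hr.symm.nonneg
  have e1 : 1 / r + 1 / r' = 1 := by simpa using hr.inv_add_inv_eq_one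
  have e2 : -(r - 1) * (1 / r) + 1 / r' = 0 := by
    have : 1 / r' = 1 - 1 / r := by linarith
    rw [this]
    field_simp [hr.ne_zero]
    ring
  have hF : ∫⁻ x, F x ^ r * (a x ^ (-(r - 1)) * b x) ∂P ≤ ∫⁻ x, a x * b x ∂P := by
    refine lintegral_mono_ae ?_
    filter_upwards [ha0] with x hx
    grw [hFa x]
    rw [← mul_assoc, ← ENNReal.rpow_add _ _ hx.1 hx.2]
    simp
    exact hr.nonneg
  calc ∫⁻ x, U x * b x ∂P
      = ∫⁻ x, (U x * (a x ^ (-(r - 1)) * b x) ^ (1 / r)) * (a x * b x) ^ (1 / r') ∂P := by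
        refine lintegral_congr_ae ?_
        filter_upwards [ha0, hb0] with x hax hbx
        rw [ENNReal.mul_rpow_of_nonneg _ _ hr0, ENNReal.mul_rpow_of_nonneg _ _ hr0',
          ← ENNReal.rpow_mul]
        have hA : a x ^ (-(r - 1) * (1 / r)) * a x ^ (1 / r') = 1 := by
          rw [← ENNReal.rpow_add _ _ hax.1 hax.2, e2, ENNReal.rpow_zero]
        have hB : b x ^ (1 / r) * b x ^ (1 / r') = b x := by
          rw [← ENNReal.rpow_add _ _ hbx.1 hbx.2, e1, ENNReal.rpow_one]
        calc U x * b x = U x * ((a x ^ (-(r - 1) * (1 / r)) * a x ^ (1 / r')) *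
              (b x ^ (1 / r) * b x ^ (1 / r'))) := by rw [hA, hB, one_mul]
          _ = _ := by ring
    _ ≤ (∫⁻ x, (U x * (a x ^ (-(r - 1)) * b x) ^ (1 / r)) ^ r ∂P) ^ (1 / r) *
          (∫⁻ x, ((a x * b x) ^ (1 / r')) ^ r' ∂P) ^ (1 / r') :=
        ENNReal.lintegral_mul_le_Lp_mul_Lq P hr (by fun_prop) (by fun_prop)
    _ = (∫⁻ x, U x ^ r * (a x ^ (-(r - 1)) * b x) ∂P) ^ (1 / r) *
          (∫⁻ x, a x * b x ∂P) ^ (1 / r') := by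
        simp_rw [ENNReal.mul_rpow_of_nonneg (U _) _ hr.nonneg, ← ENNReal.rpow_mul,
          one_div_mul_cancel hr.ne_zero, one_div_mul_cancel hr.symm.ne_zero, ENNReal.rpow_one]
    _ ≤ (C * ∫⁻ x, a x * b x ∂P) ^ (1 / r) * (∫⁻ x, a x * b x ∂P) ^ (1 / r') := by
        gcongr
        exact h.trans (by gcongr)
    _ = _ := by
        rw [ENNReal.mul_rpow_of_nonneg _ _ hr0, mul_assoc, ← ENNReal.rpow_add_of_nonneg _ _ hr0 hr0',
          e1, ENNReal.rpow_one]

lemma lintegral_mul_le_of_dual {P : Measure Ω} {p q : ℝ} (hpq : p.HolderConjugate q)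
    {w σ a b : Ω → ℝ≥0∞} (ha : Measurable a) (hb : Measurable b) (hw : Measurable w)
    (hσ : Measurable σ) (hdual : ∀ᵐ x ∂P, σ x ^ (p - 1) * w x = 1) :
    ∫⁻ x, a x * b x ∂P ≤
      (∫⁻ x, a x ^ p * w x ∂P) ^ (1 / p) * (∫⁻ x, b x ^ q * σ x ∂P) ^ (1 / q) := by
  have hp0 : 0 ≤ 1 / p := by simpa using hpq.nonneg
  have hq0 : 0 ≤ 1 / q := by simpa using hpq.symm.nonneg
  have e : (p - 1) * (1 / p) = 1 / q := by
    have := hpq.inv_add_inv_eq_one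
    rw [sub_mul, mul_one_div_cancel hpq.ne_zero]
    simp only [one_div]
    linarith
  calc ∫⁻ x, a x * b x ∂P = ∫⁻ x, (a x * w x ^ (1 / p)) * (b x * σ x ^ (1 / q)) ∂P := by
        refine lintegral_congr_ae ?_
        filter_upwards [hdual] with x hx
        calc a x * b x = a x * b x * (σ x ^ (p - 1) * w x) ^ (1 / p) := by simp [hx]
          _ = _ := by
            rw [ENNReal.mul_rpow_of_nonneg _ _ hp0, ← ENNReal.rpow_mul, e]
            ring
    _ ≤ (∫⁻ x, (a x * w x ^ (1 / p)) ^ p ∂P) ^ (1 / p) *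
          (∫⁻ x, (b x * σ x ^ (1 / q)) ^ q ∂P) ^ (1 / q) :=
        ENNReal.lintegral_mul_le_Lp_mul_Lq P hpq (by fun_prop) (by fun_prop)
    _ = _ := by
        simp_rw [ENNReal.mul_rpow_of_nonneg _ _ hpq.nonneg,
          ENNReal.mul_rpow_of_nonneg _ _ hpq.symm.nonneg, ← ENNReal.rpow_mul,
          one_div_mul_cancel hpq.ne_zero, one_div_mul_cancel hpq.symm.ne_zero, ENNReal.rpow_one]

/-- Extrapolation for pairs of positive functions with finite norms. -/
lemma exists_extrapolation_of_pos (P : Measure Ω) [IsFiniteMeasure P] (ℱ : Filtration ℕ mΩ)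
    {r p : ℝ} (hr : 1 < r) (hp : 1 < p) (K : ℝ≥0) :
    ∃ K' : ℝ≥0, ∀ C' : ℝ≥0, ∃ C : ℝ≥0, ∀ w σ : Ω → ℝ≥0∞, IsMuckenhouptPair P ℱ p K w σ →
      ∀ U F : Ω → ℝ≥0∞, Measurable U → Measurable F →
        (∀ x, 0 < U x) → (∀ x, 0 < F x) → ∫⁻ x, U x ^ p * w x ∂P ≠ ∞ →
        ∫⁻ x, F x ^ p * w x ∂P ≠ ∞ →
        (∀ v τ : Ω → ℝ≥0∞, IsMuckenhouptPair P ℱ r K' v τ →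
          ∫⁻ x, U x ^ r * v x ∂P ≤ C' * ∫⁻ x, F x ^ r * v x ∂P) →
        ∫⁻ x, U x ^ p * w x ∂P ≤ C * ∫⁻ x, F x ^ p * w x ∂P := by
  have hpq := Real.HolderConjugate.conjExponent hp
  set q := p.conjExponent
  have hrr := Real.HolderConjugate.conjExponent hr
  set r' := r.conjExponent
  obtain ⟨C₁, D₁, hD₁, h₁⟩ := exists_rubioDeFrancia P ℱ hp K
  obtain ⟨C₂, D₂, hD₂, h₂⟩ := exists_rubioDeFrancia P ℱ hpq.symm.lt (K ^ (q - 1))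
  -- The A_r constant of the constructed weight depends only on K, p and r for the given filtered
  -- space. It is fixed before C', which in applications is the L^r bound for that constant.
  refine ⟨D₁ ^ (r - 1) * D₂, fun C' =>
    ⟨(C' ^ (1 / r) * C₁ ^ (1 / p) * C₂ ^ (1 / q)) ^ p, fun w σ hw U F hU hF hU0 hF0 hUt hFt hUF => ?_⟩⟩
  have hp0 : 0 ≤ 1 / p := by simpa using hpq.nonneg
  have hq0 : 0 ≤ 1 / q := by simpa using hpq.symm.nonneg
  have hr0 : 0 ≤ 1 / r := by simpa using hrr.nonneg
  have hwm := hw.measurable_left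
  have hσm := hw.measurable_right
  have hne := hw.dual.mono fun x hx => ne_zero_ne_top_of_rpow_mul_eq_one hpq.sub_one_pos hx
  -- The dual function norming U: U g = U^p w, and its norm in L^q(σ) is controlled by the same
  -- integral.
  set g : Ω → ℝ≥0∞ := fun x => U x ^ (p - 1) * w x with hg
  obtain ⟨a, ham, hFa, haI, haE⟩ := h₁ w σ hw F hF
  obtain ⟨b, hbm, hgb, hbI, hbE⟩ := h₂ σ w (hw.symm hpq) g (by fun_prop)
  have hgI : ∫⁻ x, g x ^ q * σ x ∂P = ∫⁻ x, U x ^ p * w x ∂P := by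
    refine lintegral_congr_ae ?_
    filter_upwards [hw.dual, hne] with x hx hxne
    have := div_rpow_mul_eq hpq.symm.lt (rpow_mul_eq_one_symm hpq hx) (g x)
    rw [← this, hg]
    simp only
    rw [mul_div_assoc, ENNReal.div_self hxne.2.1 hxne.2.2, mul_one, ← ENNReal.rpow_mul,
      hpq.sub_one_mul_conj]
  rw [hgI] at hbI
  have ha0 : ∀ᵐ x ∂P, a x ≠ 0 ∧ a x ≠ ∞ := by
    filter_upwards [ae_ne_top_of_lintegral_rpow_mul_ne_top hpq.pos ham hwm
      (hne.mono fun _ hx => hx.2.1) (ne_top_of_le_ne_top (by finiteness) haI)] with x hx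
    exact ⟨((hF0 x).trans_le (hFa x)).ne', hx⟩
  have hb0 : ∀ᵐ x ∂P, b x ≠ 0 ∧ b x ≠ ∞ := by
    filter_upwards [ae_ne_top_of_lintegral_rpow_mul_ne_top hpq.symm.pos hbm hσm
      (hne.mono fun _ hx => hx.1.1) (ne_top_of_le_ne_top (by finiteness) hbI), hne] with x hx hxne
    refine ⟨(lt_of_lt_of_le ?_ (hgb x)).ne', hx⟩
    exact pos_iff_ne_zero.2 (mul_ne_zero
      (ENNReal.rpow_pos_of_nonneg (hU0 x) hpq.sub_one_pos.le).ne' hxne.2.1)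
  have hv := isMuckenhouptPair_of_factors hrr ham hbm ha0 hb0 hD₁ hD₂ haE hbE
  have hUb := lintegral_mul_le_of_factors hrr hU ham hbm ha0 hb0 hFa (hUF _ _ hv)
  have hab := lintegral_mul_le_of_dual hpq ham hbm hwm hσm hw.dual
  rw [ENNReal.coe_rpow_of_nonneg _ hpq.nonneg]
  refine le_of_le_mul_rpow_mul_rpow hpq hUt ?_
  calc ∫⁻ x, U x ^ p * w x ∂P ≤ ∫⁻ x, U x * b x ∂P := by
        refine lintegral_mono fun x => ?_
        dsimp only
        rw [rpow_eq_rpow_sub_one_mul (U x) hp.le, mul_comm _ (U x), mul_assoc]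
        exact mul_le_mul_right (hgb x) _
    _ ≤ (C' : ℝ≥0∞) ^ (1 / r) * ((C₁ * ∫⁻ x, F x ^ p * w x ∂P) ^ (1 / p) *
          (C₂ * ∫⁻ x, U x ^ p * w x ∂P) ^ (1 / q)) := by
        refine hUb.trans (mul_le_mul_right (hab.trans ?_) _)
        gcongr
    _ = _ := by
        rw [ENNReal.mul_rpow_of_nonneg _ _ hp0, ENNReal.mul_rpow_of_nonneg _ _ hq0]
        push_cast [ENNReal.coe_rpow_of_nonneg _ hp0, ENNReal.coe_rpow_of_nonneg _ hq0,
          ENNReal.coe_rpow_of_nonneg _ hr0]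
        ring

/-- The Rubio de Francia extrapolation theorem for Muckenhoupt weights with respect to an
arbitrary filtration. -/
theorem exists_extrapolation (P : Measure Ω) [IsFiniteMeasure P] (ℱ : Filtration ℕ mΩ)
    {r p : ℝ} (hr : 1 < r) (hp : 1 < p) (K : ℝ≥0) :
    ∃ K' : ℝ≥0, ∀ C' : ℝ≥0, ∃ C : ℝ≥0, ∀ w σ : Ω → ℝ≥0∞, IsMuckenhouptPair P ℱ p K w σ →
      ∫⁻ x, w x ∂P ≠ ∞ → ∀ U F : Ω → ℝ≥0∞, Measurable U → Measurable F →
        (∀ v τ : Ω → ℝ≥0∞, IsMuckenhouptPair P ℱ r K' v τ →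
          ∫⁻ x, U x ^ r * v x ∂P ≤ C' * ∫⁻ x, F x ^ r * v x ∂P) →
        ∫⁻ x, U x ^ p * w x ∂P ≤ C * ∫⁻ x, F x ^ p * w x ∂P := by
  have hr0 : 0 < r := by linarith
  have hp0 : 0 < p := by linarith
  obtain ⟨K', hK'⟩ := exists_extrapolation_of_pos P ℱ hr hp K
  refine ⟨K', fun C' => ?_⟩
  -- For the shifted pair, C' pays for U^r and 1 for ε^r, as ε ≤ F + ε; 2^r comes from splitting the
  -- power of a sum.
  obtain ⟨C, hC⟩ := hK' (2 ^ r * (C' + 1))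
  -- The summand 1 keeps the constant nonzero, so that the right side is ∞ when the norm of F is.
  refine ⟨C * 2 ^ p + 1, fun w σ hw hwI U F hU hF hUF => ?_⟩
  have hwm := hw.measurable_left
  rcases eq_or_ne (∫⁻ x, F x ^ p * w x ∂P) ∞ with hFt | hFt
  · rw [hFt, ENNReal.mul_top (by simp)]
    exact le_top
  have hadd : ∀ (G : Ω → ℝ≥0∞) (ε : ℝ≥0), Measurable G →
      ∫⁻ x, (G x + ε) ^ p * w x ∂P ≤
        2 ^ p * (∫⁻ x, G x ^ p * w x ∂P + (ε : ℝ≥0∞) ^ p * ∫⁻ x, w x ∂P) := by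
    intro G ε hG
    calc _ ≤ ∫⁻ x, 2 ^ p * (G x ^ p * w x + (ε : ℝ≥0∞) ^ p * w x) ∂P := by
          refine lintegral_mono fun x => ?_
          dsimp only
          grw [ENNReal.add_rpow_le_two_rpow_mul_rpow_add_rpow _ _ hp0.le, mul_assoc, add_mul]
      _ = _ := by
          rw [lintegral_const_mul _ (by fun_prop), lintegral_add_left (by fun_prop),
            lintegral_const_mul _ hwm]
  -- Truncation at N and the shift by ε supply the finiteness and positivity required before; both
  -- use that w has finite mass.
  have hmain : ∀ (N ε : ℝ≥0), 0 < ε → ∫⁻ x, min (U x) N ^ p * w x ∂P ≤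
      C * 2 ^ p * ∫⁻ x, F x ^ p * w x ∂P + C * 2 ^ p * (∫⁻ x, w x ∂P) * (ε : ℝ≥0∞) ^ p := by
    intro N ε hε
    have hε' : (0 : ℝ≥0∞) < ε := by exact_mod_cast hε
    have hV : Measurable fun x => min (U x) N := hU.min measurable_const
    have hVt : ∫⁻ x, min (U x) N ^ p * w x ∂P ≠ ∞ := by
      refine ne_top_of_le_ne_top (b := ∫⁻ x, (N : ℝ≥0∞) ^ p * w x ∂P) ?_ ?_
      · rw [lintegral_const_mul _ hwm]
        finiteness
      · refine lintegral_mono fun x => ?_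
        dsimp only
        gcongr
        exact min_le_right _ _
    have := hC w σ hw (fun x => min (U x) N + ε) (fun x => F x + ε) (by fun_prop) (by fun_prop)
      (fun x => by positivity) (fun x => by positivity)
      (ne_top_of_le_ne_top (by finiteness) (hadd _ ε hV))
      (ne_top_of_le_ne_top (by finiteness) (hadd _ ε hF)) ?_
    · calc _ ≤ ∫⁻ x, (min (U x) N + ε) ^ p * w x ∂P := by
            refine lintegral_mono fun x => ?_
            dsimp only
            gcongr
            exact le_self_add
        _ ≤ C * (2 ^ p * (∫⁻ x, F x ^ p * w x ∂P + (ε : ℝ≥0∞) ^ p * ∫⁻ x, w x ∂P)) :=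
            this.trans (mul_le_mul_right (hadd F ε hF) _)
        _ = _ := by ring
    · intro v τ hv
      have hvm := hv.measurable_left
      calc _ ≤ ∫⁻ x, 2 ^ r * (U x ^ r * v x + (ε : ℝ≥0∞) ^ r * v x) ∂P := by
            refine lintegral_mono fun x => ?_
            dsimp only
            grw [min_le_left, ENNReal.add_rpow_le_two_rpow_mul_rpow_add_rpow _ _ hr0.le, mul_assoc,
              add_mul]
        _ = 2 ^ r * (∫⁻ x, U x ^ r * v x ∂P + ∫⁻ x, (ε : ℝ≥0∞) ^ r * v x ∂P) := by
            rw [lintegral_const_mul _ (by fun_prop), lintegral_add_left (by fun_prop)]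
        _ ≤ 2 ^ r * (C' * ∫⁻ x, (F x + ε) ^ r * v x ∂P + 1 * ∫⁻ x, (F x + ε) ^ r * v x ∂P) := by
            refine mul_le_mul_right (add_le_add ?_ ?_) _
            · refine (hUF v τ hv).trans (mul_le_mul_right (lintegral_mono fun x => ?_) _)
              dsimp only
              gcongr
              exact le_self_add
            · rw [one_mul]
              refine lintegral_mono fun x => ?_
              dsimp only
              gcongr
              exact le_add_self
        _ = _ := by
            push_cast [ENNReal.coe_rpow_of_nonneg _ hr0.le]
            ring
  have hN : ∀ N : ℝ≥0, ∫⁻ x, min (U x) N ^ p * w x ∂P ≤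
      C * 2 ^ p * ∫⁻ x, F x ^ p * w x ∂P := by
    intro N
    refine ENNReal.le_of_forall_pos_le_add fun δ hδ _ => ?_
    set B : ℝ≥0∞ := C * 2 ^ p * (∫⁻ x, w x ∂P) with hB
    have hBt : B ≠ ∞ := by rw [hB]; finiteness
    lift B to ℝ≥0 using hBt with B'
    refine (hmain N ((δ / (B' + 1)) ^ (1 / p)) (NNReal.rpow_pos (by positivity))).trans ?_
    gcongr
    rw [← ENNReal.coe_rpow_of_nonneg _ hp0.le, ← NNReal.rpow_mul, one_div_mul_cancel hp0.ne',
      NNReal.rpow_one, ← ENNReal.coe_mul, ENNReal.coe_le_coe, mul_div_assoc', div_le_iff₀ (by positivity)]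
    nlinarith
  calc ∫⁻ x, U x ^ p * w x ∂P ≤ ∫⁻ x, ⨆ N : ℕ, min (U x) (N : ℝ≥0) ^ p * w x ∂P := by
        refine lintegral_mono fun x => ?_
        dsimp only
        rw [← ENNReal.iSup_mul]
        refine mul_le_mul_left ?_ _
        rw [← ENNReal.le_rpow_inv_iff hp0]
        refine le_of_forall_lt fun c hc => ?_
        obtain ⟨n, hn⟩ := ENNReal.exists_nat_gt (ne_top_of_lt hc)
        refine (lt_min hc (by simpa using hn) : c < min (U x) ((n : ℝ≥0) : ℝ≥0∞)).trans_le ?_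
        rw [ENNReal.le_rpow_inv_iff hp0]
        exact le_iSup (fun N : ℕ => min (U x) ((N : ℝ≥0) : ℝ≥0∞) ^ p) n
    _ = ⨆ N : ℕ, ∫⁻ x, min (U x) (N : ℝ≥0) ^ p * w x ∂P := by
        rw [lintegral_iSup]
        · intro n; fun_prop
        · intro m n hmn x
          dsimp only
          gcongr
    _ ≤ C * 2 ^ p * ∫⁻ x, F x ^ p * w x ∂P := iSup_le fun N => hN N
    _ ≤ _ := by
        push_cast [ENNReal.coe_rpow_of_nonneg _ hp0.le]
        gcongr
        exact le_self_add

end Extrapolation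

/-! ### The weighted ℓ^r-valued inequality. -/

section VectorValued

variable {Ω : Type*} {mΩ : MeasurableSpace Ω}

/-- The pointwise `ℓ^r` norm of a sequence of `[0,∞]`-valued functions. -/
noncomputable def lrNorm (r : ℝ) (f : ℕ → Ω → ℝ≥0∞) (x : Ω) : ℝ≥0∞ :=
  (∑' j, f j x ^ r) ^ (1 / r)

lemma measurable_lrNorm {r : ℝ} {f : ℕ → Ω → ℝ≥0∞} (hf : ∀ j, Measurable (f j)) :
    Measurable (lrNorm r f) := by
  unfold lrNorm
  fun_prop

lemma lrNorm_rpow {r : ℝ} (hr : r ≠ 0) (f : ℕ → Ω → ℝ≥0∞) (x : Ω) :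
    lrNorm r f x ^ r = ∑' j, f j x ^ r := by
  rw [lrNorm, ← ENNReal.rpow_mul, one_div_mul_cancel hr, ENNReal.rpow_one]

lemma lrNorm_indicator {r : ℝ} (hr : 0 < r) (s : Set Ω) (f : ℕ → Ω → ℝ≥0∞) :
    lrNorm r (fun j => s.indicator (f j)) = s.indicator (lrNorm r f) := by
  ext x
  by_cases hx : x ∈ s <;> simp [lrNorm, hx, hr]

/-- The weighted Fefferman–Stein inequality for Muckenhoupt weights. -/
theorem exists_lrNorm_condMax_le (P : Measure Ω) [IsFiniteMeasure P] (ℱ : Filtration ℕ mΩ)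
    {r p : ℝ} (hr : 1 < r) (hp : 1 < p) (K : ℝ≥0) :
    ∃ C : ℝ≥0, ∀ w σ : Ω → ℝ≥0∞, IsMuckenhouptPair P ℱ p K w σ → ∫⁻ x, w x ∂P ≠ ∞ →
      ∀ f : ℕ → Ω → ℝ≥0∞, (∀ j, Measurable (f j)) →
        ∫⁻ x, lrNorm r (fun j => condMax P ℱ (f j)) x ^ p * w x ∂P ≤
          C * ∫⁻ x, lrNorm r f x ^ p * w x ∂P := by
  obtain ⟨K', hK'⟩ := exists_extrapolation P ℱ hr hp K
  obtain ⟨C', hC'⟩ := exists_condMax_strong_type P ℱ hr K'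
  obtain ⟨C, hC⟩ := hK' C'
  refine ⟨C, fun w σ hw hwI f hf => hC w σ hw hwI _ _
    (measurable_lrNorm fun j => measurable_condMax (f j)) (measurable_lrNorm hf) fun v τ hv => ?_⟩
  have hvm := hv.measurable_left
  -- At exponent r the inequality decouples into scalar ones for each j.
  simp_rw [lrNorm_rpow (by linarith : r ≠ 0), ← ENNReal.tsum_mul_right]
  rw [lintegral_tsum fun j => by fun_prop, lintegral_tsum fun j => by fun_prop,
    ← ENNReal.tsum_mul_left]
  exact ENNReal.tsum_le_tsum fun j => hC' v τ hv (f j) (hf j)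

end VectorValued

/-! ### Uniform A_s constants for the weights φ(·,t). -/

section UniformWeights

variable {Ω : Type*} {mΩ : MeasurableSpace Ω}

/-- The weights `φ(·, t)`, `φ ∈ A_q`, belong to `A_s`, `s > q`, uniformly in `t`. -/
theorem IsAq.exists_isMuckenhouptPair {P : Measure Ω} [IsFiniteMeasure P] {ℱ : Filtration ℕ mΩ}
    {φ : Ω → ℝ≥0 → ℝ≥0} (hφ : ∀ t, Measurable fun x => φ x t) {q s : ℝ} (h : IsAq P ℱ φ q)
    (hs : q < s) :
    ∃ K : ℝ≥0, ∀ t : ℝ≥0, 0 < t → IsMuckenhouptPair P ℱ s K (fun x => (φ x t : ℝ≥0∞))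
      (fun x => (φ x t : ℝ≥0∞) ^ (-(1 / (s - 1)))) := by
  obtain ⟨hq1, hpos, K, hK0, hK⟩ := h
  have hs1 : 0 < s - 1 := by linarith
  have hm : ∀ t, Measurable fun x => (φ x t : ℝ≥0∞) := fun t => (hφ t).coe_nnreal_ennreal
  have hdual : ∀ t : ℝ≥0, 0 < t →
      ∀ x, ((φ x t : ℝ≥0∞) ^ (-(1 / (s - 1)))) ^ (s - 1) * (φ x t : ℝ≥0∞) = 1 := by
    intro t ht x
    rw [← ENNReal.rpow_mul, neg_mul, one_div_mul_cancel hs1.ne', ENNReal.rpow_neg_one]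
    exact ENNReal.inv_mul_cancel (by exact_mod_cast (hpos x t ht).ne') ENNReal.coe_ne_top
  rcases hq1.eq_or_lt with rfl | hq1
  · refine ⟨K, fun t ht => ⟨hm t, (hm t).pow_const _, ae_of_all _ (hdual t ht), fun n => ?_⟩⟩
    have hA1 : ∀ᵐ x ∂P, condLExp (ℱ n) P (fun y => (φ y t : ℝ≥0∞)) x ≤ K * φ x t := by
      filter_upwards [hK t ht n] with x hx
      exact (ENNReal.div_le_iff (by exact_mod_cast (hpos x t ht).ne') ENNReal.coe_ne_top).1
        (hx.2 rfl)
    filter_upwards [condLExp_rpow_neg_mul_le (b := fun _ => 1) measurable_const hK0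
      (one_div_nonneg.2 hs1.le) n hA1] with x hx
    simp only [mul_one] at hx
    rw [condLExp_const (ℱ.le n), mul_one] at hx
    set A := condLExp (ℱ n) P (fun y => (φ y t : ℝ≥0∞)) x
    calc _ ≤ A * ((K : ℝ≥0∞) ^ (1 / (s - 1)) * A ^ (-(1 / (s - 1)))) ^ (s - 1) := by
          gcongr
      _ = K * (A * A⁻¹) := by
          rw [ENNReal.mul_rpow_of_nonneg _ _ hs1.le, ← ENNReal.rpow_mul, ← ENNReal.rpow_mul,
            neg_mul, one_div_mul_cancel hs1.ne', ENNReal.rpow_neg_one, ENNReal.rpow_one]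
          ring
      _ ≤ K * 1 := by gcongr; exact ENNReal.mul_inv_le_one _
      _ = K := mul_one _
  · have hq0 : 0 < q - 1 := by linarith
    refine ⟨2 ^ (s - 1) * K,
      fun t ht => ⟨hm t, (hm t).pow_const _, ae_of_all _ (hdual t ht), fun n => ?_⟩⟩
    -- Jensen with θ = (q-1)/(s-1) ≤ 1 passes from the dual power for q to the one for s; its factor
    -- 2 becomes 2^(s-1).
    have hθ := condLExp_rpow_le (P := P) (ℱ.le n)
      (g := fun y => (φ y t : ℝ≥0∞) ^ (-(1 / (q - 1)))) ((hm t).pow_const _)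
      (ae_of_all _ fun x => (ENNReal.rpow_pos (by exact_mod_cast hpos x t ht)
        ENNReal.coe_ne_top).ne') (θ := (q - 1) / (s - 1)) (by positivity)
      ((div_le_one hs1).2 (by linarith))
    have e : ∀ y, ((φ y t : ℝ≥0∞) ^ (-(1 / (q - 1)))) ^ ((q - 1) / (s - 1)) =
        (φ y t : ℝ≥0∞) ^ (-(1 / (s - 1))) := by
      intro y
      rw [← ENNReal.rpow_mul]
      congr 1
      field_simp
    simp_rw [e] at hθ
    filter_upwards [hθ, hK t ht n] with x hx hKx
    calc _ ≤ condLExp (ℱ n) P (fun y => (φ y t : ℝ≥0∞)) x *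
          (2 * condLExp (ℱ n) P (fun y => (φ y t : ℝ≥0∞) ^ (-(1 / (q - 1)))) x ^
            ((q - 1) / (s - 1))) ^ (s - 1) := by gcongr
      _ = 2 ^ (s - 1) * (condLExp (ℱ n) P (fun y => (φ y t : ℝ≥0∞)) x *
          condLExp (ℱ n) P (fun y => (φ y t : ℝ≥0∞) ^ (-(1 / (q - 1)))) x ^ (q - 1)) := by
          rw [ENNReal.mul_rpow_of_nonneg _ _ hs1.le, ← ENNReal.rpow_mul,
            div_mul_cancel₀ _ hs1.ne']
          ring
      _ ≤ 2 ^ (s - 1) * K := by gcongr; exact hKx.1 hq1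
      _ = _ := by
          push_cast [ENNReal.coe_rpow_of_nonneg _ hs1.le]
          rfl

end UniformWeights

/-! ### Dyadic sums of φ and the type conditions. -/

section Modular

variable {Ω : Type*} {mΩ : MeasurableSpace Ω} {φ : Ω → ℝ≥0 → ℝ≥0}

lemma extend_coe (x : Ω) (t : ℝ≥0) : extend φ x t = φ x t := by simp [extend]

lemma extend_top (x : Ω) : extend φ x ∞ = ∞ := by simp [extend]

lemma extend_mono (h : ∀ x, Monotone (φ x)) (x : Ω) : Monotone (extend φ x) := by
  intro s t hst
  rcases eq_or_ne t ∞ with rfl | ht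
  · rw [extend_top]; exact le_top
  lift t to ℝ≥0 using ht
  lift s to ℝ≥0 using ne_top_of_le_ne_top ENNReal.coe_ne_top hst
  rw [extend_coe, extend_coe]
  exact_mod_cast h x (by exact_mod_cast hst)

/-- For finite u > 0 a single k with 4·2^k < u ≤ 8·2^k suffices, by upper type with dilation 8. For
u = ∞ the terms are unbounded since φ(x,·) tends to infinity. The threshold 4 is the one lost in
`lrNorm_le_of_add`. -/
lemma exists_extend_le_tsum (h : IsMusielakOrlicz φ) {p : ℝ} (hp : UniformUpperType φ p) :
    ∃ B : ℝ≥0, ∀ x u, extend φ x u ≤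
      B * ∑' k : ℤ, (if 4 * (dyadic k : ℝ≥0∞) < u then (φ x (dyadic k) : ℝ≥0∞) else 0) := by
  obtain ⟨hp0, c, hc, hcφ⟩ := hp
  refine ⟨c * 8 ^ p, fun x u => ?_⟩
  rcases eq_or_ne u ∞ with rfl | ht
  · rw [tsum_eq_top_of_forall_exists_le, ENNReal.mul_top]
    · exact le_top
    · have : (0 : ℝ≥0) < c * 8 ^ p := mul_pos hc (NNReal.rpow_pos (by norm_num))
      exact_mod_cast this.ne'
    · intro B
      obtain ⟨T, hT⟩ := ((h.tendsto_atTop x).eventually_ge_atTop B).exists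
      obtain ⟨k, hk⟩ : ∃ k : ℤ, T ≤ dyadic k := by
        obtain ⟨n, hn⟩ := pow_unbounded_of_one_lt T (one_lt_two)
        exact ⟨n, by simpa [dyadic] using hn.le⟩
      refine ⟨k, ?_⟩
      rw [if_pos (by finiteness)]
      exact_mod_cast hT.trans (h.monotone x hk)
  lift u to ℝ≥0 using ht
  rcases eq_or_ne u 0 with rfl | h0
  · rw [extend_coe, h.zero]; simp
  obtain ⟨k, hk1, hk2⟩ := exists_dyadic_lt_le (u := (u : ℝ≥0∞) / 4)
    (by simpa using h0) (by finiteness)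
  have hk1' : 4 * (dyadic k : ℝ≥0∞) < u := by
    rw [mul_comm]; exact ENNReal.mul_lt_of_lt_div hk1
  have hk2' : u ≤ 8 * dyadic k := by
    rw [ENNReal.div_le_iff (by simp) (by simp)] at hk2
    have : (u : ℝ≥0∞) ≤ ((2 * dyadic k * 4 : ℝ≥0) : ℝ≥0∞) := by push_cast; exact hk2
    calc u ≤ 2 * dyadic k * 4 := by exact_mod_cast this
      _ = 8 * dyadic k := by ring
  have := (h.monotone x hk2').trans (hcφ x (dyadic k) 8 (by norm_num))
  calc extend φ x u ≤ ((c * 8 ^ p * φ x (dyadic k) : ℝ≥0) : ℝ≥0∞) := by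
        rw [extend_coe]; exact_mod_cast this
    _ = ((c * 8 ^ p : ℝ≥0) : ℝ≥0∞) *
          (if 4 * (dyadic k : ℝ≥0∞) < u then (φ x (dyadic k) : ℝ≥0∞) else 0) := by
        rw [if_pos hk1', ENNReal.coe_mul]
    _ ≤ _ := by
        refine mul_le_mul_right ?_ _
        exact ENNReal.le_tsum (f := fun k : ℤ =>
          if 4 * (dyadic k : ℝ≥0∞) < u then (φ x (dyadic k) : ℝ≥0∞) else 0) k

lemma rpow_neg_mul_rpow_mul_rpow_div {d y : ℝ≥0∞} (hd0 : d ≠ 0) (hdt : d ≠ ∞) (hy0 : y ≠ 0)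
    (hyt : y ≠ ∞) (s p : ℝ) :
    d ^ (-s) * (y ^ s * (d / y) ^ p) = d ^ (p - s) * y ^ (-(p - s)) := by
  rw [div_eq_mul_inv, ENNReal.mul_rpow_of_ne_top hdt (ENNReal.inv_ne_top.2 hy0),
    ENNReal.inv_rpow, ← ENNReal.rpow_neg, sub_eq_neg_add, ENNReal.rpow_add _ _ hd0 hdt, neg_add,
    neg_neg, ENNReal.rpow_add _ _ hy0 hyt]
  ring

/-- Lower type compares φ(x,2^k) with (2^k/y)^p φ(x,y). What remains is a sum of 2^(k(p-s)) over 2^k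
< y, geometric because s < p. -/
lemma exists_tsum_lower_le {p s : ℝ} (hp : UniformLowerType φ p) (hs : s < p) :
    ∃ B : ℝ≥0, ∀ x y, ∑' k : ℤ, (if (dyadic k : ℝ≥0∞) < y then
      (dyadic k : ℝ≥0∞) ^ (-s) * (y ^ s * φ x (dyadic k)) else 0) ≤ B * extend φ x y := by
  obtain ⟨hp0, c, hc, hcφ⟩ := hp
  obtain ⟨C, hC, hsum⟩ := exists_tsum_dyadic_le (sub_pos.2 hs)
  refine ⟨c * C, fun x y => ?_⟩
  rcases eq_or_ne y ∞ with rfl | ht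
  · rw [extend_top, ENNReal.mul_top]
    · exact le_top
    · exact_mod_cast (mul_pos hc hC).ne'
  lift y to ℝ≥0 using ht
  rcases eq_or_ne y 0 with rfl | h0
  · simp
  have h0' : (y : ℝ≥0∞) ≠ 0 := by exact_mod_cast h0
  rw [extend_coe]
  have hterm : ∀ k : ℤ, (if (dyadic k : ℝ≥0∞) < y then
      (dyadic k : ℝ≥0∞) ^ (-s) * ((y : ℝ≥0∞) ^ s * φ x (dyadic k)) else 0) ≤
      c * φ x y * (y : ℝ≥0∞) ^ (-(p - s)) *
        (if (dyadic k : ℝ≥0∞) ≤ y then (dyadic k : ℝ≥0∞) ^ (p - s) else 0) := by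
    intro k
    split_ifs with h1 h2
    · have hlt : dyadic k / y < 1 := by
        rw [div_lt_one (pos_iff_ne_zero.2 h0)]; exact_mod_cast h1
      have h3 := hcφ x y (dyadic k / y) (div_pos (dyadic_pos k) (pos_iff_ne_zero.2 h0)) hlt
      rw [div_mul_cancel₀ _ h0] at h3
      have h4 : (φ x (dyadic k) : ℝ≥0∞) ≤ c * ((dyadic k : ℝ≥0∞) / y) ^ p * φ x y := by
        rw [← ENNReal.coe_div h0, ← ENNReal.coe_rpow_of_nonneg _ hp0.le]
        exact_mod_cast h3
      calc _ ≤ (dyadic k : ℝ≥0∞) ^ (-s) *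
            ((y : ℝ≥0∞) ^ s * (c * ((dyadic k : ℝ≥0∞) / y) ^ p * φ x y)) := by gcongr
        _ = c * φ x y * ((dyadic k : ℝ≥0∞) ^ (-s) *
            ((y : ℝ≥0∞) ^ s * ((dyadic k : ℝ≥0∞) / y) ^ p)) := by ring
        _ = _ := by
            rw [rpow_neg_mul_rpow_mul_rpow_div (dyadic_coe_ne_zero k) ENNReal.coe_ne_top h0'
              ENNReal.coe_ne_top]
            ring
    · exact absurd h1.le h2
    · exact zero_le
    · exact zero_le
  refine (ENNReal.tsum_le_tsum hterm).trans ?_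
  rw [ENNReal.tsum_mul_left]
  grw [hsum y]
  calc _ = c * C * φ x y * ((y : ℝ≥0∞) ^ (-(p - s)) * (y : ℝ≥0∞) ^ (p - s)) := by ring
    _ ≤ _ := by
      rw [← ENNReal.rpow_add _ _ h0' ENNReal.coe_ne_top, neg_add_cancel, ENNReal.rpow_zero, mul_one,
        ENNReal.coe_mul]

/-- The counterpart above y: upper type leaves 2^(-k(s-p)), summable over 2^k ≥ y because s > p. -/
lemma exists_tsum_upper_le {p s : ℝ} (hp : UniformUpperType φ p) (hs : p < s) :
    ∃ B : ℝ≥0, ∀ x y, ∑' k : ℤ, (if y ≤ (dyadic k : ℝ≥0∞) then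
      (dyadic k : ℝ≥0∞) ^ (-s) * (y ^ s * φ x (dyadic k)) else 0) ≤ B * extend φ x y := by
  obtain ⟨hp0, c, hc, hcφ⟩ := hp
  obtain ⟨C, hC, hsum⟩ := exists_tsum_dyadic_neg_le (sub_pos.2 hs)
  refine ⟨c * C, fun x y => ?_⟩
  rcases eq_or_ne y ∞ with rfl | ht
  · simp
  lift y to ℝ≥0 using ht
  rcases eq_or_ne y 0 with rfl | h0
  · simp [ENNReal.zero_rpow_of_pos (hp0.trans hs)]
  have h0' : (y : ℝ≥0∞) ≠ 0 := by exact_mod_cast h0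
  rw [extend_coe]
  have hterm : ∀ k : ℤ, (if (y : ℝ≥0∞) ≤ dyadic k then
      (dyadic k : ℝ≥0∞) ^ (-s) * ((y : ℝ≥0∞) ^ s * φ x (dyadic k)) else 0) ≤
      c * φ x y * (y : ℝ≥0∞) ^ (s - p) *
        (if (y : ℝ≥0∞) ≤ dyadic k then (dyadic k : ℝ≥0∞) ^ (-(s - p)) else 0) := by
    intro k
    split_ifs with h1
    · have hle : 1 ≤ dyadic k / y := by
        rw [one_le_div (pos_iff_ne_zero.2 h0)]; exact_mod_cast h1
      have h3 := hcφ x y (dyadic k / y) hle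
      rw [div_mul_cancel₀ _ h0] at h3
      have h4 : (φ x (dyadic k) : ℝ≥0∞) ≤ c * ((dyadic k : ℝ≥0∞) / y) ^ p * φ x y := by
        rw [← ENNReal.coe_div h0, ← ENNReal.coe_rpow_of_nonneg _ hp0.le]
        exact_mod_cast h3
      calc _ ≤ (dyadic k : ℝ≥0∞) ^ (-s) *
            ((y : ℝ≥0∞) ^ s * (c * ((dyadic k : ℝ≥0∞) / y) ^ p * φ x y)) := by gcongr
        _ = c * φ x y * ((dyadic k : ℝ≥0∞) ^ (-s) *
            ((y : ℝ≥0∞) ^ s * ((dyadic k : ℝ≥0∞) / y) ^ p)) := by ring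
        _ = _ := by
            rw [rpow_neg_mul_rpow_mul_rpow_div (dyadic_coe_ne_zero k) ENNReal.coe_ne_top h0'
              ENNReal.coe_ne_top, neg_sub, neg_sub]
            ring
    · exact zero_le
  refine (ENNReal.tsum_le_tsum hterm).trans ?_
  rw [ENNReal.tsum_mul_left]
  grw [hsum y]
  calc _ = c * C * φ x y * ((y : ℝ≥0∞) ^ (s - p) * (y : ℝ≥0∞) ^ (-(s - p))) := by ring
    _ ≤ _ := by
      rw [← ENNReal.rpow_add _ _ h0' ENNReal.coe_ne_top, add_neg_cancel, ENNReal.rpow_zero, mul_one,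
        ENNReal.coe_mul]

end Modular

/-! ### Truncation and the modular inequality. -/

section Interpolation

variable {Ω : Type*} {mΩ : MeasurableSpace Ω}

lemma condMax_add_le {P : Measure Ω} {ℱ : Filtration ℕ mΩ} {f g : Ω → ℝ≥0∞} (hf : Measurable f) :
    ∀ᵐ x ∂P, condMax P ℱ (f + g) x ≤ condMax P ℱ f x + condMax P ℱ g x := by
  have h := fun n => condLExp_add_left (mΩ := ℱ n) (P := P) g hf.aemeasurable
  filter_upwards [ae_all_iff.2 h] with x hx
  refine iSup_le fun n => ?_
  rw [hx n]
  exact add_le_add (le_iSup (fun n => condLExp (ℱ n) P f x) n)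
    (le_iSup (fun n => condLExp (ℱ n) P g x) n)

/-- A crude substitute for Minkowski: one factor 2 from the power of a sum, another from 2 ≤ 2^r. -/
lemma lrNorm_le_of_add {r : ℝ} (hr : 1 ≤ r) {u v w : ℕ → Ω → ℝ≥0∞} {x : Ω}
    (h : ∀ j, u j x ≤ v j x + w j x) {t : ℝ≥0∞} (hv : lrNorm r v x ≤ t) (hw : lrNorm r w x ≤ t) :
    lrNorm r u x ≤ 4 * t := by
  have hr0 : 0 < r := by linarith
  rw [← ENNReal.rpow_le_rpow_iff hr0, lrNorm_rpow hr0.ne']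
  calc ∑' j, u j x ^ r ≤ ∑' j, 2 ^ r * (v j x ^ r + w j x ^ r) := by
        refine ENNReal.tsum_le_tsum fun j => ?_
        grw [h j, ENNReal.add_rpow_le_two_rpow_mul_rpow_add_rpow _ _ hr0.le]
    _ = 2 ^ r * (lrNorm r v x ^ r + lrNorm r w x ^ r) := by
        rw [ENNReal.tsum_mul_left, ENNReal.tsum_add, lrNorm_rpow hr0.ne', lrNorm_rpow hr0.ne']
    _ ≤ 2 ^ r * (t ^ r + t ^ r) := by gcongr
    _ = 2 ^ r * (2 * t ^ r) := by rw [two_mul]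
    _ ≤ 2 ^ r * (2 ^ r * t ^ r) := by
        gcongr
        exact ENNReal.le_rpow_self_of_one_le (by norm_num) hr
    _ = (4 * t) ^ r := by
        rw [ENNReal.mul_rpow_of_nonneg _ _ hr0.le, ← mul_assoc,
          ← ENNReal.mul_rpow_of_nonneg _ _ hr0.le]
        norm_num

lemma one_le_rpow_neg_mul_rpow {t u : ℝ≥0∞} (h0 : t ≠ 0) (ht : t ≠ ∞) {s : ℝ} (hs : 0 ≤ s)
    (h : t < u) : 1 ≤ t ^ (-s) * u ^ s := by
  calc (1 : ℝ≥0∞) = t ^ (-s) * t ^ s := by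
        rw [← ENNReal.rpow_add _ _ h0 ht, neg_add_cancel, ENNReal.rpow_zero]
    _ ≤ _ := by gcongr

/-- The distributional estimate obtained by truncating at height `t` and using two exponents. -/
theorem lintegral_lt_lrNorm_condMax_le {P : Measure Ω} {ℱ : Filtration ℕ mΩ} {w : Ω → ℝ≥0∞}
    (hw : Measurable w) {r s₁ s₂ : ℝ} (hr : 1 ≤ r) (hs₁ : 0 < s₁) (hs₂ : 0 < s₂) {C₁ C₂ : ℝ≥0}
    (h₁ : ∀ f : ℕ → Ω → ℝ≥0∞, (∀ j, Measurable (f j)) →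
        ∫⁻ x, lrNorm r (fun j => condMax P ℱ (f j)) x ^ s₁ * w x ∂P ≤
          C₁ * ∫⁻ x, lrNorm r f x ^ s₁ * w x ∂P)
    (h₂ : ∀ f : ℕ → Ω → ℝ≥0∞, (∀ j, Measurable (f j)) →
        ∫⁻ x, lrNorm r (fun j => condMax P ℱ (f j)) x ^ s₂ * w x ∂P ≤
          C₂ * ∫⁻ x, lrNorm r f x ^ s₂ * w x ∂P)
    {f : ℕ → Ω → ℝ≥0∞} (hf : ∀ j, Measurable (f j)) {t : ℝ≥0∞} (h0 : t ≠ 0) (ht : t ≠ ∞) :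
    ∫⁻ x, (if 4 * t < lrNorm r (fun j => condMax P ℱ (f j)) x then w x else 0) ∂P ≤
      C₁ * ∫⁻ x, (if t < lrNorm r f x then t ^ (-s₁) * (lrNorm r f x ^ s₁ * w x) else 0) ∂P +
      C₂ * ∫⁻ x, (if lrNorm r f x ≤ t then t ^ (-s₂) * (lrNorm r f x ^ s₂ * w x) else 0) ∂P := by
  have hr0 : 0 < r := by linarith
  have hF : Measurable (lrNorm r f) := measurable_lrNorm hf
  -- All f_j are cut along one set, defined by the ℓ^r norm, so truncation commutes with `lrNorm`.
  set S : Set Ω := {x | t < lrNorm r f x} with hS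
  have hSm : MeasurableSet S := measurableSet_lt measurable_const hF
  set U₁ := lrNorm r (fun j => condMax P ℱ (S.indicator (f j))) with hU₁
  set U₂ := lrNorm r (fun j => condMax P ℱ (Sᶜ.indicator (f j))) with hU₂
  have hU₁m : Measurable U₁ := measurable_lrNorm fun j => measurable_condMax _
  have hU₂m : Measurable U₂ := measurable_lrNorm fun j => measurable_condMax _
  have ht1 : t ^ (-s₁) ≠ ∞ := ENNReal.rpow_ne_top_of_ne_zero h0 ht
  have ht2 : t ^ (-s₂) ≠ ∞ := ENNReal.rpow_ne_top_of_ne_zero h0 ht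
  have hsplit : ∀ j, ∀ᵐ x ∂P, condMax P ℱ (f j) x ≤
      condMax P ℱ (S.indicator (f j)) x + condMax P ℱ (Sᶜ.indicator (f j)) x := by
    intro j
    have := condMax_add_le (P := P) (ℱ := ℱ) (g := Sᶜ.indicator (f j)) ((hf j).indicator hSm)
    rwa [Set.indicator_self_add_compl] at this
  calc _ ≤ ∫⁻ x, t ^ (-s₁) * (U₁ x ^ s₁ * w x) + t ^ (-s₂) * (U₂ x ^ s₂ * w x) ∂P := by
        refine lintegral_mono_ae ?_
        filter_upwards [ae_all_iff.2 hsplit] with x hx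
        split_ifs with h
        -- Above 4t at least one of U₁, U₂ exceeds t, and Chebyshev applies with the matching
        -- exponent.
        · by_cases h1 : t < U₁ x
          · refine le_add_right ?_
            rw [← mul_assoc]
            exact le_mul_of_one_le_left' (one_le_rpow_neg_mul_rpow h0 ht hs₁.le h1)
          by_cases h2 : t < U₂ x
          · refine le_add_left ?_
            rw [← mul_assoc]
            exact le_mul_of_one_le_left' (one_le_rpow_neg_mul_rpow h0 ht hs₂.le h2)
          · exact absurd (lrNorm_le_of_add hr hx (not_lt.1 h1) (not_lt.1 h2)) (not_le.2 h)
        · exact zero_le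
    _ = t ^ (-s₁) * ∫⁻ x, U₁ x ^ s₁ * w x ∂P + t ^ (-s₂) * ∫⁻ x, U₂ x ^ s₂ * w x ∂P := by
        rw [lintegral_add_left (by fun_prop), lintegral_const_mul' _ _ ht1,
          lintegral_const_mul' _ _ ht2]
    _ ≤ t ^ (-s₁) * (C₁ * ∫⁻ x, S.indicator (lrNorm r f) x ^ s₁ * w x ∂P) +
          t ^ (-s₂) * (C₂ * ∫⁻ x, Sᶜ.indicator (lrNorm r f) x ^ s₂ * w x ∂P) := by
        rw [← lrNorm_indicator hr0, ← lrNorm_indicator hr0]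
        gcongr
        · exact h₁ _ fun j => (hf j).indicator hSm
        · exact h₂ _ fun j => (hf j).indicator hSm.compl
    _ = _ := by
        rw [mul_left_comm, mul_left_comm (t ^ (-s₂)), ← lintegral_const_mul' _ _ ht1,
          ← lintegral_const_mul' _ _ ht2]
        congr 3 <;> ext x <;> by_cases hx : t < lrNorm r f x
        · simp [hS, hx]
        · simp [hS, hx, hs₁]
        · simp [hS, hx, hs₂]
        · simp [hS, hx, not_lt.1 hx]

/-- The modular form of the Fefferman–Stein inequality. -/
theorem exists_modular_condMax_le (P : Measure Ω) [IsFiniteMeasure P] (ℱ : Filtration ℕ mΩ)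
    {φ : Ω → ℝ≥0 → ℝ≥0} (hφ : IsMusielakOrlicz φ)
    (hφint : ∀ t : ℝ≥0, Integrable (fun x => (φ x t : ℝ)) P) {q p₁ p₂ r : ℝ}
    (hq : IsAq P ℱ φ q) (hlower : UniformLowerType φ p₁) (hupper : UniformUpperType φ p₂)
    (hqp : q < p₁) (hp : p₁ ≤ p₂) (hr : 1 < r) :
    ∃ C : ℝ≥0, ∀ f : ℕ → Ω → ℝ≥0∞, (∀ j, Measurable (f j)) →
      ∫⁻ x, extend φ x (lrNorm r (fun j => condMax P ℱ (f j)) x) ∂P ≤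
        C * ∫⁻ x, extend φ x (lrNorm r f x) ∂P := by
  -- Both exponents exceed q, so every φ(·,t) lies in A_{s₁} and A_{s₂}, and they lie strictly on
  -- either side of [p₁, p₂], so both dyadic sums converge.
  obtain ⟨s₁, hs₁, hs₁p⟩ := exists_between hqp
  obtain ⟨s₂, hs₂⟩ := exists_gt p₂
  have h1s₁ : 1 < s₁ := hq.1.trans_lt hs₁
  have h1s₂ : 1 < s₂ := by linarith
  obtain ⟨K₁, hK₁⟩ := hq.exists_isMuckenhouptPair hφ.measurable hs₁
  obtain ⟨K₂, hK₂⟩ := hq.exists_isMuckenhouptPair hφ.measurable (by linarith : q < s₂)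
  obtain ⟨C₁, hC₁⟩ := exists_lrNorm_condMax_le P ℱ hr h1s₁ K₁
  obtain ⟨C₂, hC₂⟩ := exists_lrNorm_condMax_le P ℱ hr h1s₂ K₂
  obtain ⟨B, hB⟩ := exists_extend_le_tsum hφ hupper
  obtain ⟨B₁, hB₁⟩ := exists_tsum_lower_le hlower hs₁p
  obtain ⟨B₂, hB₂⟩ := exists_tsum_upper_le hupper hs₂
  refine ⟨B * (C₁ * B₁ + C₂ * B₂), fun f hf => ?_⟩
  set U := lrNorm r (fun j => condMax P ℱ (f j)) with hU
  set F := lrNorm r f with hF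
  have hUm : Measurable U := measurable_lrNorm fun j => measurable_condMax _
  have hFm : Measurable F := measurable_lrNorm hf
  have hφm : ∀ k : ℤ, Measurable fun x => (φ x (dyadic k) : ℝ≥0∞) := fun k =>
    (hφ.measurable _).coe_nnreal_ennreal
  have hfin : ∀ t : ℝ≥0, ∫⁻ x, (φ x t : ℝ≥0∞) ∂P ≠ ∞ := by
    intro t
    have := (hφint t).hasFiniteIntegral
    simpa [HasFiniteIntegral, enorm] using this.ne
  -- The weight changes with the height 2^k, whereas C₁ and C₂ do not: this is where uniformity in t
  -- enters.
  have hdist := fun k : ℤ => lintegral_lt_lrNorm_condMax_le (hφm k) hr.le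
    (by linarith) (by linarith)
    (hC₁ _ _ (hK₁ _ (dyadic_pos k)) (hfin _)) (hC₂ _ _ (hK₂ _ (dyadic_pos k)) (hfin _)) hf
    (dyadic_coe_ne_zero k) ENNReal.coe_ne_top
  calc ∫⁻ x, extend φ x (U x) ∂P
      ≤ ∫⁻ x, B * ∑' k : ℤ,
          (if 4 * (dyadic k : ℝ≥0∞) < U x then (φ x (dyadic k) : ℝ≥0∞) else 0) ∂P :=
        lintegral_mono fun x => hB x _
    _ = B * ∑' k : ℤ, ∫⁻ x,
          (if 4 * (dyadic k : ℝ≥0∞) < U x then (φ x (dyadic k) : ℝ≥0∞) else 0) ∂P := by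
        rw [lintegral_const_mul' _ _ ENNReal.coe_ne_top, lintegral_tsum]
        exact fun k => (Measurable.ite (measurableSet_lt measurable_const hUm) (hφm k)
          measurable_const).aemeasurable
    _ ≤ B * (C₁ * ∑' k : ℤ, ∫⁻ x, (if (dyadic k : ℝ≥0∞) < F x then
            (dyadic k : ℝ≥0∞) ^ (-s₁) * (F x ^ s₁ * φ x (dyadic k)) else 0) ∂P +
          C₂ * ∑' k : ℤ, ∫⁻ x, (if F x ≤ (dyadic k : ℝ≥0∞) then
            (dyadic k : ℝ≥0∞) ^ (-s₂) * (F x ^ s₂ * φ x (dyadic k)) else 0) ∂P) := by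
        refine mul_le_mul_right ?_ _
        rw [← ENNReal.tsum_mul_left, ← ENNReal.tsum_mul_left, ← ENNReal.tsum_add]
        exact ENNReal.tsum_le_tsum hdist
    _ = B * (C₁ * ∫⁻ x, ∑' k : ℤ, (if (dyadic k : ℝ≥0∞) < F x then
            (dyadic k : ℝ≥0∞) ^ (-s₁) * (F x ^ s₁ * φ x (dyadic k)) else 0) ∂P +
          C₂ * ∫⁻ x, ∑' k : ℤ, (if F x ≤ (dyadic k : ℝ≥0∞) then
            (dyadic k : ℝ≥0∞) ^ (-s₂) * (F x ^ s₂ * φ x (dyadic k)) else 0) ∂P) := by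
        rw [lintegral_tsum, lintegral_tsum]
        · exact fun k => (Measurable.ite (measurableSet_le hFm measurable_const)
            (((hFm.pow_const _).mul (hφm k)).const_mul _) measurable_const).aemeasurable
        · exact fun k => (Measurable.ite (measurableSet_lt measurable_const hFm)
            (((hFm.pow_const _).mul (hφm k)).const_mul _) measurable_const).aemeasurable
    _ ≤ B * (C₁ * ∫⁻ x, B₁ * extend φ x (F x) ∂P + C₂ * ∫⁻ x, B₂ * extend φ x (F x) ∂P) := by
        refine mul_le_mul_right (add_le_add (mul_le_mul_right (lintegral_mono fun x => ?_) _)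
          (mul_le_mul_right (lintegral_mono fun x => ?_) _)) _
        · exact hB₁ x _
        · exact hB₂ x _
    _ = _ := by
        rw [lintegral_const_mul' _ _ ENNReal.coe_ne_top, lintegral_const_mul' _ _ ENNReal.coe_ne_top]
        push_cast
        ring

end Interpolation

/-! ### Signed functions and dilations. -/

section Luxemburg

variable {Ω : Type*} {mΩ : MeasurableSpace Ω}

lemma enorm_toReal_sub_toReal_le (a b : ℝ≥0∞) : ‖a.toReal - b.toReal‖ₑ ≤ max a b := by
  rw [Real.enorm_eq_ofReal_abs]
  have ha : 0 ≤ a.toReal := ENNReal.toReal_nonneg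
  have hb : 0 ≤ b.toReal := ENNReal.toReal_nonneg
  rcases le_total a.toReal b.toReal with h | h
  · refine le_trans ?_ (le_max_right _ _)
    refine le_trans (ENNReal.ofReal_le_ofReal ?_) ENNReal.ofReal_toReal_le
    rw [abs_le]; constructor <;> linarith
  · refine le_trans ?_ (le_max_left _ _)
    refine le_trans (ENNReal.ofReal_le_ofReal ?_) ENNReal.ofReal_toReal_le
    rw [abs_le]; constructor <;> linarith

lemma absCondExp_le {Ω : Type*} {m mΩ : MeasurableSpace Ω} {P : Measure Ω} (f : Ω → ℝ) :
    ∀ᵐ x ∂P, absCondExp P m f x ≤ condLExp m P (fun y => ‖f y‖ₑ) x := by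
  have h1 := condLExp_mono (mΩ := m) (P := P) (X := fun y => ENNReal.ofReal (f y))
    (Y := fun y => ‖f y‖ₑ) (ae_of_all _ fun x => by
      simp only [Real.enorm_eq_ofReal_abs]; exact ENNReal.ofReal_le_ofReal (le_abs_self _))
  have h2 := condLExp_mono (mΩ := m) (P := P) (X := fun y => ENNReal.ofReal (-f y))
    (Y := fun y => ‖f y‖ₑ) (ae_of_all _ fun x => by
      simp only [Real.enorm_eq_ofReal_abs]; exact ENNReal.ofReal_le_ofReal (neg_le_abs _))
  filter_upwards [h1, h2] with x h1 h2
  rw [absCondExp]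
  split_ifs with h
  · rw [h]
  · exact (enorm_toReal_sub_toReal_le _ _).trans (max_le h1 h2)

lemma doobMax_div_le {P : Measure Ω} {ℱ : Filtration ℕ mΩ} {f : Ω → ℝ} (hf : Measurable f)
    (c : ℝ≥0∞) :
    ∀ᵐ x ∂P, doobMax P ℱ f x / c ≤ condMax P ℱ (fun y => ‖f y‖ₑ / c) x := by
  have h1 := fun n => absCondExp_le (P := P) (m := ℱ n) f
  have h2 := fun n => condLExp_smul (mΩ := ℱ n) (P := P) (fun y => ‖f y‖ₑ)
    hf.enorm.aemeasurable c⁻¹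
  have e : (fun y => ‖f y‖ₑ / c) = c⁻¹ • fun y => ‖f y‖ₑ := by
    ext y; simp [div_eq_mul_inv, mul_comm]
  filter_upwards [ae_all_iff.2 h1, ae_all_iff.2 h2] with x h1 h2
  rw [doobMax, div_eq_mul_inv, ENNReal.iSup_mul]
  refine iSup_le fun n => le_trans ?_ (le_iSup _ n)
  rw [e, h2 n, mul_comm]
  exact mul_le_mul_right (h1 n) _

lemma lrNorm_div {r : ℝ} (hr : 0 < r) (f : ℕ → Ω → ℝ≥0∞) (c : ℝ≥0∞) (x : Ω) :
    lrNorm r (fun j y => f j y / c) x = lrNorm r f x / c := by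
  rw [lrNorm, lrNorm]
  simp_rw [div_eq_mul_inv, ENNReal.mul_rpow_of_nonneg _ _ hr.le]
  rw [ENNReal.tsum_mul_right, ENNReal.mul_rpow_of_nonneg _ _ (by positivity), ← ENNReal.rpow_mul,
    one_mul, mul_inv_cancel₀ hr.ne', ENNReal.rpow_one]

/-- Lower type at 1/Λ gains c Λ^(-p), which beats C once Λ^p ≥ c C. -/
lemma exists_extend_div_le {φ : Ω → ℝ≥0 → ℝ≥0} {p : ℝ} (hp : UniformLowerType φ p) (C : ℝ≥0) :
    ∃ Λ : ℝ≥0, 0 < Λ ∧ ∀ x u, C * extend φ x (u / Λ) ≤ extend φ x u := by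
  obtain ⟨hp0, c, hc, hcφ⟩ := hp
  -- The summand 2 makes Λ = B^(1/p) exceed 1, so lower type is applicable.
  set B : ℝ≥0 := c * C + 2 with hB
  have hB1 : 1 < B := by
    rw [hB]; exact lt_of_lt_of_le (by norm_num : (1 : ℝ≥0) < 2) le_add_self
  have hΛ1 : 1 < B ^ (1 / p) := NNReal.one_lt_rpow hB1 (by positivity)
  have hΛ0 := one_pos.trans hΛ1
  refine ⟨B ^ (1 / p), hΛ0, fun x u => ?_⟩
  rcases eq_or_ne u ∞ with rfl | hu
  · rw [extend_top]; exact le_top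
  lift u to ℝ≥0 using hu
  rw [← ENNReal.coe_div hΛ0.ne', extend_coe, extend_coe]
  have := hcφ x u (B ^ (1 / p))⁻¹ (inv_pos.2 hΛ0) (inv_lt_one_of_one_lt₀ hΛ1)
  rw [mul_comm _ u, ← div_eq_mul_inv, NNReal.inv_rpow, ← NNReal.rpow_mul,
    one_div_mul_cancel hp0.ne', NNReal.rpow_one] at this
  have key : C * φ x (u / B ^ (1 / p)) ≤ φ x u := by
    calc C * φ x (u / B ^ (1 / p)) ≤ C * (c * B⁻¹ * φ x u) := by gcongr
      _ = (c * C) / B * φ x u := by rw [div_eq_mul_inv]; ring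
      _ ≤ 1 * φ x u := by
          gcongr
          exact div_le_one_of_le₀ (by rw [hB]; exact le_self_add) zero_le
      _ = _ := one_mul _
  exact_mod_cast key

end Luxemburg

end MusielakOrlicz

/-! ### From the modular inequality to the norm inequality. -/

theorem mainTheorem4 {Ω : Type*} [mΩ : MeasurableSpace Ω] (P : Measure Ω) [IsProbabilityMeasure P]
    (ℱ : Filtration ℕ mΩ) (φ : Ω → ℝ≥0 → ℝ≥0)
    (hφ : MusielakOrlicz.IsMusielakOrlicz φ)
    (hφint : ∀ t : ℝ≥0, Integrable (fun x => (φ x t : ℝ)) P)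
    (hA : MusielakOrlicz.IsAInfty P ℱ φ)
    (pminus pplus : ℝ)
    (hlower : MusielakOrlicz.UniformLowerType φ pminus)
    (hupper : MusielakOrlicz.UniformUpperType φ pplus)
    (hq : MusielakOrlicz.criticalIndex P ℱ φ < pminus) (hp : pminus ≤ pplus)
    (r : ℝ) (hr : 1 < r) :
    ∃ C : ℝ≥0, 0 < C ∧ ∀ f : ℕ → Ω → ℝ, (∀ j, Measurable (f j)) →
      MusielakOrlicz.luxemburgNorm P φ
          (fun x => (∑' j, MusielakOrlicz.doobMax P ℱ (f j) x ^ r) ^ (1 / r)) ≤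
        C * MusielakOrlicz.luxemburgNorm P φ
          (fun x => (∑' j, ‖f j x‖ₑ ^ r) ^ (1 / r)) := by
  obtain ⟨q, hAq, hqp⟩ := exists_lt_of_csInf_lt hA hq
  obtain ⟨B, hB⟩ := MusielakOrlicz.exists_modular_condMax_le P ℱ hφ hφint hAq hlower hupper hqp hp hr
  obtain ⟨Λ, hΛ, hΛφ⟩ := MusielakOrlicz.exists_extend_div_le hlower B
  have hr0 : 0 < r := by linarith
  refine ⟨Λ, hΛ, fun f hf => ?_⟩
  rw [← ENNReal.div_le_iff' (by exact_mod_cast hΛ.ne') ENNReal.coe_ne_top]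
  refine le_iInf fun c => le_iInf fun hc => le_iInf fun hF => ?_
  rw [ENNReal.div_le_iff (by exact_mod_cast hΛ.ne') ENNReal.coe_ne_top, ← ENNReal.coe_mul]
  -- If c is admissible for the ℓ^r norm of f, then cΛ is admissible for that of the maximal
  -- functions: the modular constant B is absorbed by the dilation Λ.
  refine iInf_le_of_le (c * Λ) (iInf_le_of_le (mul_pos hc hΛ) (iInf_le_of_le ?_ le_rfl))
  set g : ℕ → Ω → ℝ≥0∞ := fun j y => ‖f j y‖ₑ / c with hg
  have hgm : ∀ j, Measurable (g j) := fun j => (hf j).enorm.div measurable_const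
  set h : ℕ → Ω → ℝ≥0∞ := fun j y => g j y / Λ with hh
  have hhm : ∀ j, Measurable (h j) := fun j => (hgm j).div measurable_const
  have hscale : ∀ x, MusielakOrlicz.lrNorm r g x = (∑' j, ‖f j x‖ₑ ^ r) ^ (1 / r) / c :=
    fun x => MusielakOrlicz.lrNorm_div hr0 (fun j y => ‖f j y‖ₑ) c x
  have hΛc : ∀ u : ℝ≥0∞, u / ((c * Λ : ℝ≥0) : ℝ≥0∞) = u / c / Λ := by
    intro u
    rw [ENNReal.coe_mul, div_eq_mul_inv, ENNReal.mul_inv (by simp [hc.ne']) (by simp),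
      ← mul_assoc, ← div_eq_mul_inv, ← div_eq_mul_inv]
  calc _ ≤ ∫⁻ x, MusielakOrlicz.extend φ x
        (MusielakOrlicz.lrNorm r (fun j => MusielakOrlicz.condMax P ℱ (h j)) x) ∂P := by
        refine lintegral_mono_ae ?_
        filter_upwards [ae_all_iff.2 fun j => MusielakOrlicz.doobMax_div_le (P := P) (ℱ := ℱ) (hf j)
          ((c * Λ : ℝ≥0) : ℝ≥0∞)] with x hx
        refine MusielakOrlicz.extend_mono hφ.monotone x ?_
        refine (MusielakOrlicz.lrNorm_div hr0 (fun j => MusielakOrlicz.doobMax P ℱ (f j)) _ x).ge.trans ?_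
        refine ENNReal.rpow_le_rpow (ENNReal.tsum_le_tsum fun j => ENNReal.rpow_le_rpow ?_ hr0.le)
          (by positivity)
        simpa only [hh, hg, hΛc] using hx j
    _ ≤ B * ∫⁻ x, MusielakOrlicz.extend φ x (MusielakOrlicz.lrNorm r h x) ∂P := hB h hhm
    _ = ∫⁻ x, B * MusielakOrlicz.extend φ x (MusielakOrlicz.lrNorm r g x / Λ) ∂P := by
        rw [← lintegral_const_mul' _ _ ENNReal.coe_ne_top]
        simp_rw [hh, MusielakOrlicz.lrNorm_div hr0]
    _ ≤ ∫⁻ x, MusielakOrlicz.extend φ x (MusielakOrlicz.lrNorm r g x) ∂P :=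
        lintegral_mono fun x => hΛφ x _
    _ ≤ 1 := by simpa only [hscale] using hF
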